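/- **Sklyanin variables of the open Toda lattice are only "almost" Darboux–Nijenhuis.** Let $n\ge 1$ and let $M=\mathbb R^{2n}$ with coordinates $(q_1,\dots,q_n,p_1,\dots,p_n)$ carry the Poisson tensors $$P=\sum_{i=1}^n \frac{\partial}{\partial q_i}\wedge\frac{\partial}{\partial p_i},\qquad P'=\sum_{i=1}^{n-1}e^{q_i-q_{i+1}}\frac{\partial}{\partial p_{i+1}}\wedge\frac{\partial}{\partial p_i}+\sum_{i=1}^n p_i\frac{\partial}{\partial q_i}\wedge\frac{\partial}{\partial p_i}+\sum_{i<j}\frac{\partial}{\partial q_j}\wedge\frac{\partial}{\partial q_i},$$ with brackets $\{f,g\}=\langle df,P\,dg\rangle$, $\{f,g\}'=\langle df,P'dg\rangle$ (so $\{q_i,p_j\}=\delta_{ij}$), symplectic form $\omega=P^{-1}$, i.e. $\omega(X,Y)=\langle P^{-1}X,Y\rangle$, and recursion operator $N=P'P^{-1}$. Let $$T(\lambda)=\begin{pmatrix}A&B\\ C&D\end{pmatrix}(\lambda)=L_1(\lambda)\cdots L_n(\lambda),\qquad L_i=\begin{pmatrix}\lambda-p_i&-e^{q_i}\\ e^{-q_i}&0\end{pmatrix}.$$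 Sklyanin variables on an open set $U\subseteq M$ are functions $u_1,\dots,u_n,v_1,\dots,v_n:U\to\mathbb C$ such that $u_1,\dots,u_{n-1}$ is a continuous labelling of the roots of $B(\lambda)$ with multiplicity, $v_j=-\ln A(u_j)$ for $j<n$ with a continuous branch of the logarithm, $u_n=\sum_{i=1}^n p_i$ and $v_n=-q_n$. Tensors are understood with complex coefficients. 1. Sklyanin variables exist on all of $M$, with the principal branch of the logarithm. Let now $(u,v)$ be any Sklyanin variables on an open set $U$. Then the following hold on $U$. 2. All $u_i$ are real, $\operatorname{Im}v_i\in\pi\mathbb Z$, the roots $u_1,\dots,u_{n-1}$ are pairwise distinct, and $B(\lambda)=-e^{-v_n}\prod_{j=1}^{n-1}(\lambda-u_j)$. 3. $(u,v)$ are Darboux coordinates on $U$: these functions are smooth, separate the points of $U$, have linearly independent differentials at each point, and $\omega=\sum_{i=1}^n du_i\wedge dv_i$. 4. For all $1\le i,j\le n$: $\{u_i,v_j\}=\delta_{ij}$ and $\{u_i,u_j\}=\{v_i,v_j\}=0$. 5. For all $1\le i,j\le n-1$: $\{u_i,v_j\}'=u_i\delta_{ij}$, $\{u_i,u_j\}'=\{v_i,v_j\}'=0$,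 and $$\{u_n,u_i\}'=f_i:=-\frac{e^{-v_i}}{\prod_{j\ne i,\,j<n}(u_i-u_j)},\qquad \{u_n,v_i\}'=g_i:=-e^{-v_n}\frac{A'(u_i)}{B'(u_i)},$$ $$\{v_n,u_i\}'=0,\qquad \{v_n,v_i\}'=1,\qquad \{u_n,v_n\}'=s:=u_n-\sum_{i=1}^{n-1}u_i .$$ 6. With $\partial/\partial u_i,\partial/\partial v_i$ the frame dual to $du_i,dv_i$, $$\begin{aligned}N={}&\sum_{i=1}^{n-1}u_i\Big(\frac{\partial}{\partial u_i}\otimes du_i+\frac{\partial}{\partial v_i}\otimes dv_i\Big)+s\Big(\frac{\partial}{\partial u_n}\otimes du_n+\frac{\partial}{\partial v_n}\otimes dv_n\Big)\\&+\sum_{i=1}^{n-1}f_i\Big(\frac{\partial}{\partial u_i}\otimes dv_n-\frac{\partial}{\partial u_n}\otimes dv_i\Big)+\sum_{i=1}^{n-1}\Big(\frac{\partial}{\partial v_n}\otimes du_i-\frac{\partial}{\partial v_i}\otimes du_n\Big)\\&+\sum_{i=1}^{n-1}g_i\Big(\frac{\partial}{\partial v_i}\otimes dv_n+\frac{\partial}{\partial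 u_n}\otimes du_i\Big).\end{aligned}$$ 7. If $n\ge2$ and $U\neq\emptyset$, then $(u,v)$ are not Darboux–Nijenhuis coordinates on $U$, i.e. there are no functions $\lambda_1,\dots,\lambda_n$ on $U$ with $N=\sum_{i=1}^n\lambda_i\big(\frac{\partial}{\partial u_i}\otimes du_i+\frac{\partial}{\partial v_i}\otimes dv_i\big)$. -/

import Mathlib

open scoped ContDiff

noncomputable section

namespace Toda

/-- Index set of the coordinates of `ℝ²ⁿ`: `Sum.inl i` labels `q_i`, `Sum.inr i` labels `p_i`. -/
abbrev Idx (n : ℕ) : Type := Fin n ⊕ Fin n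

/-- The phase space `M = ℝ²ⁿ` with its global coordinates `(q, p)`. -/
abbrev Phase (n : ℕ) : Type := Idx n → ℝ

/-- The position `q_i` of a phase point. -/
def q {n : ℕ} (z : Phase n) (i : Fin n) : ℝ := z (Sum.inl i)

/-- The momentum `p_i` of a phase point. -/
def p {n : ℕ} (z : Phase n) (i : Fin n) : ℝ := z (Sum.inr i)

/-! ### Tensor calculus on `M`

Functions on `M` are complex valued, and tensors at a point have complex components with respect to
the frame `∂/∂q_i, ∂/∂p_i`. -/

/-- The differential `dF` at `z`, as the row of the partial derivatives of `F`. -/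
def differential {n : ℕ} (F : Phase n → ℂ) (z : Phase n) : Idx n → ℂ :=
  fun a => fderiv ℝ F z (Pi.single a 1)

/-- The bivector `∂_a ∧ ∂_b = ∂_a ⊗ ∂_b - ∂_b ⊗ ∂_a`. -/
def wedgeVec {n : ℕ} (a b : Idx n) : Matrix (Idx n) (Idx n) ℂ :=
  Matrix.single a b 1 - Matrix.single b a 1

/-- The two-form `dF ∧ dG = dF ⊗ dG - dG ⊗ dF` at `z`. -/
def wedgeForm {n : ℕ} (F G : Phase n → ℂ) (z : Phase n) : Matrix (Idx n) (Idx n) ℂ :=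
  Matrix.vecMulVec (differential F z) (differential G z)
    - Matrix.vecMulVec (differential G z) (differential F z)

/-- The bracket `{F, G} = ⟨dF, Π dG⟩ = ∑ Π^{ab} ∂_a F ∂_b G` of a bivector field `Π`. -/
def bracket {n : ℕ} (biv : Phase n → Matrix (Idx n) (Idx n) ℂ) (F G : Phase n → ℂ)
    (z : Phase n) : ℂ :=
  ∑ a, ∑ b, biv z a b * differential F z a * differential G z b

/-- The canonical Poisson tensor `P = ∑ ∂/∂q_i ∧ ∂/∂p_i`. -/
def P (n : ℕ) (_z : Phase n) : Matrix (Idx n) (Idx n) ℂ :=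
  ∑ i : Fin n, wedgeVec (Sum.inl i) (Sum.inr i)

/-- The second Poisson tensor of the open Toda lattice with `n = m + 1` particles,
`P' = ∑_{i<n} e^{q_i - q_{i+1}} ∂/∂p_{i+1} ∧ ∂/∂p_i + ∑_i p_i ∂/∂q_i ∧ ∂/∂p_i
  + ∑_{i<j} ∂/∂q_j ∧ ∂/∂q_i`. -/
def P' (m : ℕ) (z : Phase (m + 1)) : Matrix (Idx (m + 1)) (Idx (m + 1)) ℂ :=
  (∑ i : Fin m, (Real.exp (q z i.castSucc - q z i.succ) : ℂ) •
      wedgeVec (Sum.inr i.succ) (Sum.inr i.castSucc))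
  + (∑ i : Fin (m + 1), (p z i : ℂ) • wedgeVec (Sum.inl i) (Sum.inr i))
  + ∑ i : Fin (m + 1), ∑ j ∈ Finset.Ioi i, wedgeVec (Sum.inl j) (Sum.inl i)

/-- The recursion operator `N = P' P⁻¹`, acting on (columns of components of) tangent vectors. -/
def recursionOperator (m : ℕ) (z : Phase (m + 1)) : Matrix (Idx (m + 1)) (Idx (m + 1)) ℂ :=
  P' m z * (P (m + 1) z)⁻¹

/-- The symplectic form `ω = P⁻¹`, that is `ω(X, Y) = ⟨P⁻¹ X, Y⟩`, as the matrix
`ω_{ab} = ω(∂_a, ∂_b)`. With this sign `ω(P dF, P dG) = {F, G}`. -/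
def symplecticForm (n : ℕ) (z : Phase n) : Matrix (Idx n) (Idx n) ℂ :=
  ((P n z)⁻¹).transpose

/-- The Jacobian matrix `J_{ab} = ∂_b X_a` of a family of functions. -/
def jacobian {n : ℕ} (X : Idx n → Phase n → ℂ) (z : Phase n) : Matrix (Idx n) (Idx n) ℂ :=
  Matrix.of fun a b => differential (X a) z b

/-- `X` is a system of (complex valued) coordinates on the set `U`: the functions are smooth, separate
the points of `U`, and their differentials form a basis at each point of `U`. -/
structure IsCoordinateSystem {n : ℕ} (U : Set (Phase n)) (X : Idx n → Phase n → ℂ) : Prop where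
  smooth : ∀ a, ContDiffOn ℝ ∞ (X a) U
  injOn : Set.InjOn (fun z a => X a z) U
  isUnit_jacobian : ∀ z ∈ U, IsUnit (jacobian X z)

/-- The coordinate vector field `∂/∂X_a`, i.e. the frame dual to the differentials `dX_a`. -/
def coordVec {n : ℕ} (X : Idx n → Phase n → ℂ) (a : Idx n) (z : Phase n) : Idx n → ℂ :=
  fun b => (jacobian X z)⁻¹ b a

/-- The `(1,1)`-tensor `∂/∂X_a ⊗ dX_b` at `z`. -/
def tens {n : ℕ} (X : Idx n → Phase n → ℂ) (a b : Idx n) (z : Phase n) :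
    Matrix (Idx n) (Idx n) ℂ :=
  Matrix.vecMulVec (coordVec X a z) (differential (X b) z)

/-- The family of `2n` functions `(x_i, y_i)`; `Sum.inl i` labels `x_i`, `Sum.inr i` labels `y_i`. -/
def pair {n : ℕ} (x y : Fin n → Phase n → ℂ) : Idx n → Phase n → ℂ := Sum.elim x y

/-- `(x_i, y_i)` are Darboux coordinates on `U`: `ω = ∑ dx_i ∧ dy_i`. -/
structure IsDarboux {n : ℕ} (U : Set (Phase n)) (x y : Fin n → Phase n → ℂ) : Prop where
  coords : IsCoordinateSystem U (pair x y)
  canonical : ∀ z ∈ U, symplecticForm n z = ∑ i, wedgeForm (x i) (y i) z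

/-- `(x_i, y_i)` are Darboux-Nijenhuis coordinates on `U`: they are Darboux coordinates and
`N = ∑ λ_i (∂/∂x_i ⊗ dx_i + ∂/∂y_i ⊗ dy_i)` for some functions `λ_i`. -/
structure IsDarbouxNijenhuis {m : ℕ} (U : Set (Phase (m + 1)))
    (x y : Fin (m + 1) → Phase (m + 1) → ℂ) : Prop where
  darboux : IsDarboux U x y
  diagonal : ∃ lam : Fin (m + 1) → Phase (m + 1) → ℂ, ∀ z ∈ U,
    recursionOperator m z = ∑ i, lam i z •
      (tens (pair x y) (Sum.inl i) (Sum.inl i) z + tens (pair x y) (Sum.inr i) (Sum.inr i) z)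

/-! ### Monodromy matrix and Sklyanin variables -/

open Polynomial in
/-- The local matrix `L_i(λ)`, with rows `(λ - p_i, -e^{q_i})` and `(e^{-q_i}, 0)`. -/
def localLax {n : ℕ} (z : Phase n) (i : Fin n) : Matrix (Fin 2) (Fin 2) ℂ[X] :=
  !![X - C (p z i : ℂ), -C (Real.exp (q z i) : ℂ);
     C (Real.exp (-q z i) : ℂ), 0]

open Polynomial in
/-- The monodromy matrix `T(λ) = L_1(λ) ⋯ L_n(λ)`. -/
def monodromy {n : ℕ} (z : Phase n) : Matrix (Fin 2) (Fin 2) ℂ[X] :=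
  (List.ofFn fun i => localLax z i).prod

open Polynomial in
/-- The diagonal entry `A(λ)` of the monodromy matrix. -/
def polyA {n : ℕ} (z : Phase n) : ℂ[X] := monodromy z 0 0

open Polynomial in
/-- The off-diagonal entry `B(λ)` of the monodromy matrix. -/
def polyB {n : ℕ} (z : Phase n) : ℂ[X] := monodromy z 0 1

/-- `(u_i, v_i)` are Sklyanin variables on `U`, for `n = m + 1` particles: `u_1, …, u_{n-1}` is a
continuous labelling of the roots of `B(λ)` (with multiplicity), `v_j = -ln A(u_j)` for `j < n` with
a continuous branch of the logarithm, `u_n = ∑ p_i` and `v_n = -q_n`. -/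
structure IsSklyanin {m : ℕ} (U : Set (Phase (m + 1)))
    (u v : Fin (m + 1) → Phase (m + 1) → ℂ) : Prop where
  continuousOn_u : ∀ j : Fin m, ContinuousOn (u j.castSucc) U
  continuousOn_v : ∀ j : Fin m, ContinuousOn (v j.castSucc) U
  roots_B : ∀ z ∈ U, (polyB z).roots =
    (Finset.univ : Finset (Fin m)).val.map fun j => u j.castSucc z
  exp_neg_v : ∀ z ∈ U, ∀ j : Fin m,
    Complex.exp (-v j.castSucc z) = (polyA z).eval (u j.castSucc z)
  u_last : ∀ z ∈ U, u (Fin.last m) z = ∑ i, (p z i : ℂ)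
  v_last : ∀ z ∈ U, v (Fin.last m) z = -(q z (Fin.last m) : ℂ)

/-- `f_i = - e^{-v_i} / ∏_{j ≠ i} (u_i - u_j)`, the product over `j < n`, for `i < n`. -/
def fCoef {m : ℕ} (u v : Fin (m + 1) → Phase (m + 1) → ℂ) (i : Fin m) (z : Phase (m + 1)) : ℂ :=
  -(Complex.exp (-v i.castSucc z) /
    ∏ j ∈ Finset.univ.erase i, (u i.castSucc z - u j.castSucc z))

open Polynomial in
/-- `g_i = - e^{-v_n} A'(u_i) / B'(u_i)`, for `i < n`. -/
def gCoef {m : ℕ} (u v : Fin (m + 1) → Phase (m + 1) → ℂ) (i : Fin m) (z : Phase (m + 1)) : ℂ :=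
  -Complex.exp (-v (Fin.last m) z) *
    ((derivative (polyA z)).eval (u i.castSucc z) / (derivative (polyB z)).eval (u i.castSucc z))

/-- `s = u_n - ∑_{i<n} u_i`. -/
def sCoef {m : ℕ} (u : Fin (m + 1) → Phase (m + 1) → ℂ) (z : Phase (m + 1)) : ℂ :=
  u (Fin.last m) z - ∑ i : Fin m, u i.castSucc z

end Toda

end

/-! Everything is read off the first row (A_k, B_k) of the partial products L_1 ⋯ L_k, which obeys a
two-term recursion in k. Three facts about this row carry the proof.

Since det L_k = 1 and L_k depends on λ only through its upper left entry, the Wronskian A B' - A' B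
increases by e^{q_k} A_k² at each step and is positive on the real line (`wronskian_pos`). The same
computation with conjugate points instead of derivatives shows that B has no nonreal zero
(`im_mul_im_pos`). Hence the zeros u_j of B are real and simple and A(u_j) ≠ 0: the logarithm makes
sense, and the implicit function theorem makes u_j and v_j smooth.

The brackets of A and B at two values of λ are quadratic in A and B (`TodaRelations.row_row`,
`TodaRelations.row_row_self`). They are proved by induction on the number of particles for s{·,·} +
t{·,·}', so one computation serves both Poisson tensors. At zeros of B nearly all terms vanish. What
survives gives the brackets of u_j and v_j for j < n. The total momentum and q_n are handled by the
analogous linear recursions `TodaRelations.total_row` and `TodaRelations.last_pos_row`.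

The canonical brackets for P say that the Jacobian of (u, v) is symplectic. This yields independence
of the differentials and ω = ∑ du_i ∧ dv_i, and it turns the table of second brackets into the
matrix of N in the dual frame (`mul_P_inv_eq_sum_tens`). The entry {v_n, v_1}' = 1 lies off the
diagonal and excludes Darboux–Nijenhuis coordinates. Points are separated because A is interpolated
from its values at the u_j and (A, B) determines all factors L_k. -/

noncomputable section

/-! ### The first row of the partial monodromy: degrees, zeros, reconstruction of the factors. -/

namespace Toda

open Polynomial

variable {m : ℕ}

/-- The position of the `k`-th particle, with the index read modulo the number of particles. -/
def pos (z : Phase (m + 1)) (k : ℕ) : ℝ := z (Sum.inl (Fin.ofNat (m + 1) k))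

/-- The momentum of the `k`-th particle, with the index read modulo the number of particles. -/
def mom (z : Phase (m + 1)) (k : ℕ) : ℝ := z (Sum.inr (Fin.ofNat (m + 1) k))

/-- The first row of the product of the first `k` local matrices. -/
def rowPoly (z : Phase (m + 1)) : ℕ → ℝ[X] × ℝ[X]
  | 0 => (1, 0)
  | k + 1 => ((X - C (mom z k)) * (rowPoly z k).1 + C (Real.exp (-pos z k)) * (rowPoly z k).2,
      -(C (Real.exp (pos z k)) * (rowPoly z k).1))

/-- The upper left entry of the product of the first `k` local matrices. -/
def rowA (z : Phase (m + 1)) (k : ℕ) : ℝ[X] := (rowPoly z k).1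

/-- The upper right entry of the product of the first `k` local matrices. -/
def rowB (z : Phase (m + 1)) (k : ℕ) : ℝ[X] := (rowPoly z k).2

@[simp] lemma rowA_zero (z : Phase (m + 1)) : rowA z 0 = 1 := rfl

@[simp] lemma rowB_zero (z : Phase (m + 1)) : rowB z 0 = 0 := rfl

lemma rowA_succ (z : Phase (m + 1)) (k : ℕ) :
    rowA z (k + 1) = (X - C (mom z k)) * rowA z k + C (Real.exp (-pos z k)) * rowB z k := rfl

lemma rowB_succ (z : Phase (m + 1)) (k : ℕ) :
    rowB z (k + 1) = -(C (Real.exp (pos z k)) * rowA z k) := rfl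

lemma take_monodromy (z : Phase (m + 1)) (k : ℕ) (hk : k ≤ m + 1) :
    (((List.ofFn fun i => localLax z i).take k).prod 0 0 = (rowA z k).map Complex.ofRealHom) ∧
    (((List.ofFn fun i => localLax z i).take k).prod 0 1 = (rowB z k).map Complex.ofRealHom) := by
  induction k with
  | zero => simp
  | succ k ih =>
    obtain ⟨h0, h1⟩ := ih (by omega)
    have hlen : k < (List.ofFn fun i => localLax z i).length := by simpa using hk
    have hfin : (⟨k, by omega⟩ : Fin (m + 1)) = Fin.ofNat (m + 1) k := by
      ext; simp [Nat.mod_eq_of_lt (show k < m + 1 by omega)]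
    rw [List.prod_take_succ _ _ hlen]
    simp only [Matrix.mul_apply, Fin.sum_univ_two, h0, h1, List.getElem_ofFn, hfin]
    simp only [rowA_succ, rowB_succ, localLax, pos, mom, p, q]
    constructor
    · simp
      ring
    · simp
      ring

lemma polyA_eq (z : Phase (m + 1)) : polyA z = (rowA z (m + 1)).map Complex.ofRealHom := by
  have h := (take_monodromy z (m + 1) le_rfl).1
  rwa [List.take_of_length_le (by simp)] at h

lemma polyB_eq (z : Phase (m + 1)) : polyB z = (rowB z (m + 1)).map Complex.ofRealHom := by
  have h := (take_monodromy z (m + 1) le_rfl).2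
  rwa [List.take_of_length_le (by simp)] at h

lemma rowA_rowB_degree (z : Phase (m + 1)) (k : ℕ) :
    (rowA z k).Monic ∧ (rowA z k).degree = k ∧ (rowB z k).degree < k := by
  induction k with
  | zero => simp [monic_one]
  | succ k ih =>
    obtain ⟨h1, h2, h3⟩ := ih
    have hX : ((X - C (mom z k)) * rowA z k).degree = ((k + 1 : ℕ) : WithBot ℕ) := by
      rw [degree_mul, h2, degree_X_sub_C]; push_cast; ring
    have hm : ((X - C (mom z k)) * rowA z k).Monic := (monic_X_sub_C _).mul h1
    have hlt : (C (Real.exp (-pos z k)) * rowB z k).degree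
        < ((X - C (mom z k)) * rowA z k).degree := by
      rw [hX, degree_C_mul (Real.exp_pos _).ne']
      exact h3.trans (by exact_mod_cast Nat.lt_succ_self k)
    refine ⟨?_, ?_, ?_⟩
    · rw [rowA_succ]; exact hm.add_of_left hlt
    · rw [rowA_succ, degree_add_eq_left_of_degree_lt hlt, hX]
    · rw [rowB_succ, degree_neg, degree_C_mul (Real.exp_pos _).ne', h2]
      exact_mod_cast Nat.lt_succ_self k

lemma rowA_monic (z : Phase (m + 1)) (k : ℕ) : (rowA z k).Monic := (rowA_rowB_degree z k).1

lemma degree_rowA (z : Phase (m + 1)) (k : ℕ) : (rowA z k).degree = k :=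
  (rowA_rowB_degree z k).2.1

lemma natDegree_rowA (z : Phase (m + 1)) (k : ℕ) : (rowA z k).natDegree = k :=
  natDegree_eq_of_degree_eq_some (degree_rowA z k)

lemma degree_rowB_lt (z : Phase (m + 1)) (k : ℕ) : (rowB z k).degree < k :=
  (rowA_rowB_degree z k).2.2

/-- The B-term has degree too low to contribute, so the subleading coefficient sees only the
momenta. With Vieta's formula this links p_n to the roots of B. -/
lemma coeff_rowA_succ (z : Phase (m + 1)) (k : ℕ) :
    (rowA z (k + 1)).coeff k = -∑ i ∈ Finset.range (k + 1), mom z i := by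
  induction k with
  | zero => simp [rowA_succ]
  | succ k ih =>
    rw [rowA_succ, coeff_add, sub_mul, coeff_sub, coeff_X_mul, ih, coeff_C_mul, coeff_C_mul,
      coeff_eq_zero_of_degree_lt (degree_rowB_lt z (k + 1)), Finset.sum_range_succ _ (k + 1)]
    have := (rowA_monic z (k + 1)).coeff_natDegree
    rw [natDegree_rowA] at this
    rw [this]
    ring

lemma rowB_succ_ne_zero (z : Phase (m + 1)) (k : ℕ) : rowB z (k + 1) ≠ 0 := by
  rw [rowB_succ, neg_ne_zero]
  exact mul_ne_zero (C_ne_zero.2 (Real.exp_pos _).ne') (rowA_monic z k).ne_zero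

/-- The Wronskian of the first row is positive on the real line. -/
lemma wronskian_pos (z : Phase (m + 1)) (t : ℝ) (k : ℕ) :
    0 < (rowA z (k + 1)).eval t * (derivative (rowB z (k + 1))).eval t
      - (derivative (rowA z (k + 1))).eval t * (rowB z (k + 1)).eval t := by
  -- The new row is the old one times L_k. As det L_k = 1 the Wronskian is carried over, and the
  -- derivative of L_k, a single unit in the upper left corner, adds the square.
  have hstep : ∀ k, (rowA z (k + 1)).eval t * (derivative (rowB z (k + 1))).eval t
      - (derivative (rowA z (k + 1))).eval t * (rowB z (k + 1)).eval t
      = ((rowA z k).eval t * (derivative (rowB z k)).eval t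
      - (derivative (rowA z k)).eval t * (rowB z k).eval t)
        + Real.exp (pos z k) * (rowA z k).eval t ^ 2 := by
    intro k
    have he : Real.exp (-pos z k) * Real.exp (pos z k) = 1 := by rw [← Real.exp_add]; simp
    simp only [rowA_succ, rowB_succ, derivative_add, derivative_mul, derivative_neg, derivative_C,
      derivative_X, derivative_sub, eval_add, eval_mul, eval_neg, eval_sub, eval_X, eval_C,
      eval_one, eval_zero]
    linear_combination ((rowA z k).eval t * (derivative (rowB z k)).eval t
      - (derivative (rowA z k)).eval t * (rowB z k).eval t) * he
  induction k with
  | zero => rw [hstep]; simp [Real.exp_pos]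
  | succ k ih =>
    rw [hstep]
    have := mul_nonneg (Real.exp_pos (pos z (k + 1))).le (sq_nonneg ((rowA z (k + 1)).eval t))
    linarith

/-- For nonreal `w`, the imaginary part of `-a(w) conj b(w)` has the sign of `Im w`. -/
lemma im_mul_im_pos (z : Phase (m + 1)) (w : ℂ) (hw : w.im ≠ 0) (k : ℕ) :
    0 < w.im * (-(aeval w (rowA z (k + 1)) * (starRingEnd ℂ) (aeval w (rowB z (k + 1))))).im := by
  -- The Wronskian recursion with the row at conj w in place of the derivative: L_k(w) - L_k(conj w)
  -- is 2i Im w in the upper left corner.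
  have hstep : ∀ k, (-(aeval w (rowA z (k + 1)) * (starRingEnd ℂ) (aeval w (rowB z (k + 1))))).im
      = (-(aeval w (rowA z k) * (starRingEnd ℂ) (aeval w (rowB z k)))).im
        + Real.exp (pos z k) * w.im * Complex.normSq (aeval w (rowA z k)) := by
    intro k
    have he : Real.exp (-pos z k) * Real.exp (pos z k) = 1 := by rw [← Real.exp_add]; simp
    simp only [rowA_succ, rowB_succ, map_add, map_mul, map_neg, map_sub, aeval_X, aeval_C]
    simp only [Complex.coe_algebraMap, Complex.conj_ofReal, Complex.normSq_apply, Complex.add_im,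
      Complex.mul_im, Complex.mul_re, Complex.neg_im, Complex.neg_re, Complex.sub_im,
      Complex.sub_re, Complex.ofReal_re, Complex.ofReal_im, Complex.conj_re, Complex.conj_im,
      Complex.add_re]
    linear_combination ((aeval w (rowA z k)).re * (aeval w (rowB z k)).im
      - (aeval w (rowA z k)).im * (aeval w (rowB z k)).re) * he
  induction k with
  | zero => rw [hstep]; simp only [rowA_zero, rowB_zero, map_zero, map_one]; simp
            have := Real.exp_pos (pos z 0)
            have := sq_pos_of_ne_zero hw
            nlinarith
  | succ k ih =>
    rw [hstep, mul_add]
    have h1 := mul_nonneg (mul_nonneg (Real.exp_pos (pos z (k + 1))).le (sq_nonneg w.im))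
      (Complex.normSq_nonneg (aeval w (rowA z (k + 1))))
    nlinarith

lemma im_eq_zero_of_aeval_rowB (z : Phase (m + 1)) (k : ℕ) {w : ℂ}
    (h : aeval w (rowB z (k + 1)) = 0) : w.im = 0 := by
  by_contra hw
  have := im_mul_im_pos z w hw k
  simp [h] at this

/-- At a zero of B, necessarily real, the positive Wronskian reduces to A B'. Both factors matter: A
≠ 0 for the logarithm, B' ≠ 0 for simplicity of the root. -/
lemma aeval_wronskian_ne_zero (z : Phase (m + 1)) (k : ℕ) {w : ℂ}
    (h : aeval w (rowB z (k + 1)) = 0) :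
    aeval w (rowA z (k + 1)) * aeval w (derivative (rowB z (k + 1))) ≠ 0 := by
  obtain ⟨t, rfl⟩ : ∃ t : ℝ, w = t :=
    ⟨w.re, by apply Complex.ext <;> simp [im_eq_zero_of_aeval_rowB z k h]⟩
  have key : ∀ f : ℝ[X], aeval (t : ℂ) f = ((f.eval t : ℝ) : ℂ) := fun f => by
    simpa using aeval_algebraMap_apply_eq_algebraMap_eval (A := ℂ) t f
  rw [key] at h
  have h' : (rowB z (k + 1)).eval t = 0 := by exact_mod_cast h
  have hw := wronskian_pos z t k
  rw [h', mul_zero, sub_zero] at hw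
  rw [key, key]
  exact_mod_cast hw.ne'

/-- The first row of the product of the first `k` local matrices determines these matrices. -/
lemma eq_of_rowA_rowB_eq (z w : Phase (m + 1)) (k : ℕ) (hA : rowA z k = rowA w k)
    (hB : rowB z k = rowB w k) : ∀ i < k, pos z i = pos w i ∧ mom z i = mom w i := by
  induction k with
  | zero => simp
  | succ k ih =>
    have hlead := congrArg leadingCoeff hB
    simp only [rowB_succ, leadingCoeff_neg, leadingCoeff_mul, leadingCoeff_C,
      (rowA_monic _ _).leadingCoeff, mul_one, neg_inj, Real.exp_eq_exp] at hlead
    have hA' : rowA z k = rowA w k := by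
      rw [rowB_succ, rowB_succ, hlead, neg_inj] at hB
      exact mul_left_cancel₀ (C_ne_zero.2 (Real.exp_pos _).ne') hB
    -- The left side is a constant times a monic polynomial of degree k, while the right side has
    -- degree less than k. Hence the constant is zero.
    have hdiff : C (mom z k - mom w k) * rowA w k
        = C (Real.exp (-pos w k)) * (rowB z k - rowB w k) := by
      rw [rowA_succ, rowA_succ, hlead, hA'] at hA
      rw [C_sub]
      linear_combination -hA
    have hmom : mom z k = mom w k := by
      by_contra hne
      have hd := congrArg degree hdiff
      rw [degree_C_mul (sub_ne_zero.2 hne), degree_C_mul (Real.exp_pos _).ne', degree_rowA] at hd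
      have := (degree_sub_le (rowB z k) (rowB w k)).trans_lt
        (max_lt (degree_rowB_lt z k) (degree_rowB_lt w k))
      rw [← hd] at this
      exact lt_irrefl _ this
    have hB' : rowB z k = rowB w k := by
      rw [hmom, sub_self, C_0, zero_mul, eq_comm, mul_eq_zero] at hdiff
      exact sub_eq_zero.1 (hdiff.resolve_left (C_ne_zero.2 (Real.exp_pos _).ne'))
    intro i hi
    rcases Nat.lt_succ_iff_lt_or_eq.1 hi with h | rfl
    · exact ih hA' hB' i h
    · exact ⟨hlead, hmom⟩

end Toda

/-! ### Quadratic brackets of the monodromy row for the pencil of Poisson structures. -/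

namespace Toda

/-- The bracket relations `s {·,·} + t {·,·}'` of the coordinate differentials `dq_k, dp_k`, `k < n`,
of the open Toda lattice, where `x_k = e^{q_k}`, `y_k = e^{-q_k}`. -/
structure TodaRelations {V : Type*} [AddCommGroup V] [Module ℂ V] (β : LinearMap.BilinForm ℂ V)
    (s t : ℂ) (n : ℕ) (x y p : ℕ → ℂ) (dq dp : ℕ → V) : Prop where
  alt : ∀ v w, β v w = -β w v
  qq : ∀ j k, k < j → j < n → β (dq j) (dq k) = t
  qp : ∀ j k, j < n → k < n → β (dq j) (dp k) = if j = k then s + t * p k else 0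
  pp : ∀ j k, k < j → j < n → β (dp j) (dp k) = if j = k + 1 then t * (x k * y j) else 0

/-- The values `a k`, `b k` at `l` of the first row of the partial monodromy matrices, their
derivatives `a' k`, `b' k` with respect to `l` and their differentials `da k`, `db k`. -/
structure RowJet {V : Type*} [AddCommGroup V] [Module ℂ V] (x y p : ℕ → ℂ) (dq dp : ℕ → V)
    (l : ℂ) (a b a' b' : ℕ → ℂ) (da db : ℕ → V) : Prop where
  a_zero : a 0 = 1
  b_zero : b 0 = 0
  a'_zero : a' 0 = 0
  b'_zero : b' 0 = 0
  da_zero : da 0 = 0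
  db_zero : db 0 = 0
  a_succ : ∀ k, a (k + 1) = (l - p k) * a k + y k * b k
  b_succ : ∀ k, b (k + 1) = -(x k * a k)
  a'_succ : ∀ k, a' (k + 1) = a k + (l - p k) * a' k + y k * b' k
  b'_succ : ∀ k, b' (k + 1) = -(x k * a' k)
  da_succ : ∀ k, da (k + 1) = (l - p k) • da k + y k • db k - a k • dp k - (y k * b k) • dq k
  db_succ : ∀ k, db (k + 1) = -(x k • da k) - (x k * a k) • dq k

section Algebra

variable {V : Type*} [AddCommGroup V] [Module ℂ V] {β : LinearMap.BilinForm ℂ V}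
  {s t : ℂ} {n : ℕ} {x y p : ℕ → ℂ} {dq dp : ℕ → V}

lemma TodaRelations.self (H : TodaRelations β s t n x y p dq dp) (v : V) : β v v = 0 :=
  CharZero.eq_neg_self_iff.1 (H.alt v v)

lemma TodaRelations.pq (H : TodaRelations β s t n x y p dq dp) {j k : ℕ} (hj : j < n)
    (hk : k < n) : β (dp j) (dq k) = if j = k then -(s + t * p k) else 0 := by
  rw [H.alt, H.qp k j hk hj]
  by_cases h : j = k
  · simp [h]
  · simp [h, Ne.symm h]

variable {l : ℂ} {a b a' b' : ℕ → ℂ} {da db : ℕ → V}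
  {l₂ : ℂ} {a₂ b₂ a₂' b₂' : ℕ → ℂ} {da₂ db₂ : ℕ → V}

/-- Brackets of `q_j`, `p_j` with the partial monodromy of the first `k ≤ j` particles. -/
lemma TodaRelations.coord_row (H : TodaRelations β s t n x y p dq dp)
    (R : RowJet x y p dq dp l a b a' b' da db) (k : ℕ) :
    ∀ j, k ≤ j → j < n →
      β (dq j) (da k) = 0 ∧ β (dq j) (db k) = t * b k ∧
      β (dp j) (da k) = (if j = k then t * y k * b k else 0) ∧ β (dp j) (db k) = 0 := by
  induction k with
  | zero =>
    intro j _ _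
    simp [R.da_zero, R.db_zero, R.b_zero]
  | succ k ih =>
    intro j hkj hj
    obtain ⟨h1, h2, h3, h4⟩ := ih j (by omega) hj
    have hjk : j ≠ k := by omega
    simp only [R.da_succ, R.db_succ, R.b_succ, map_sub, map_add, map_neg, map_smul, smul_eq_mul, h1,
      h2, h3, h4, H.qq j k (by omega) hj, H.qp j k hj (by omega), H.pp j k (by omega) hj,
      H.pq hj (show k < n by omega), if_neg hjk]
    refine ⟨by ring, by ring, ?_, by ring⟩
    split_ifs with h
    · subst h; ring
    · ring

lemma TodaRelations.row_coord (H : TodaRelations β s t n x y p dq dp)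
    (R : RowJet x y p dq dp l a b a' b' da db) {k : ℕ} (hk : k < n) :
    β (da k) (dq k) = 0 ∧ β (db k) (dq k) = -(t * b k) ∧
      β (da k) (dp k) = -(t * y k * b k) ∧ β (db k) (dp k) = 0 := by
  obtain ⟨h1, h2, h3, h4⟩ := H.coord_row R k k le_rfl hk
  rw [H.alt (da k), H.alt (db k), H.alt (da k) (dp k), H.alt (db k) (dp k), h1, h2, h3, h4]
  simp

/-- The quadratic brackets of the first row of the partial monodromy at two points. -/
lemma TodaRelations.row_row (H : TodaRelations β s t n x y p dq dp)
    (R : RowJet x y p dq dp l a b a' b' da db)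
    (R₂ : RowJet x y p dq dp l₂ a₂ b₂ a₂' b₂' da₂ db₂) (hl : l ≠ l₂) (k : ℕ) (hk : k ≤ n) :
    β (da k) (da₂ k) = 0 ∧ β (db k) (db₂ k) = 0 ∧
    (l - l₂) * β (da k) (db₂ k) =
      s * (a k * b₂ k - a₂ k * b k) + t * (l₂ * a k * b₂ k - l * a₂ k * b k) ∧
    (l - l₂) * β (db k) (da₂ k) =
      s * (a₂ k * b k - a k * b₂ k) + t * (l * a₂ k * b k - l₂ * a k * b₂ k) := by
  have hl' : l - l₂ ≠ 0 := sub_ne_zero.2 hl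
  induction k with
  | zero => simp [R.da_zero, R.db_zero, R.b_zero, R₂.da_zero, R₂.db_zero, R₂.b_zero]
  | succ k ih =>
    obtain ⟨haa, hbb, hab, hba⟩ := ih (by omega)
    obtain ⟨h1, h2, h3, h4⟩ := H.row_coord R (show k < n by omega)
    obtain ⟨g1, g2, g3, g4⟩ := H.coord_row R₂ k k le_rfl (show k < n by omega)
    rw [if_pos rfl] at g3
    have hqp := H.qp k k hk hk
    have hpq := H.pq (j := k) (k := k) hk hk
    rw [if_pos rfl] at hqp hpq
    simp only [R.da_succ, R.db_succ, R.b_succ, R.a_succ, R₂.da_succ, R₂.db_succ, R₂.b_succ,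
      R₂.a_succ, map_sub, map_add, map_neg, map_smul, smul_eq_mul, LinearMap.sub_apply,
      LinearMap.add_apply, LinearMap.neg_apply, LinearMap.smul_apply, h1, h2, h3, h4, g1, g2, g3,
      g4, haa, hbb, H.self, hqp, hpq]
    refine ⟨?_, by ring, ?_, ?_⟩
    -- The mixed brackets are known only after multiplication by `l - l₂`, so the identity is proved
    -- with this factor and then divided by it.
    · refine mul_left_cancel₀ hl' ?_
      linear_combination (l - p k) * y k * hab + y k * (l₂ - p k) * hba
    · linear_combination -(x k * y k) * hba
    · linear_combination -(x k * y k) * hab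

/-- The brackets of the first row of the partial monodromy at coinciding points. -/
lemma TodaRelations.row_row_self (H : TodaRelations β s t n x y p dq dp)
    (R : RowJet x y p dq dp l a b a' b' da db) (k : ℕ) (hk : k ≤ n) :
    β (da k) (db k) =
      s * (a' k * b k - a k * b' k) + t * (l * (a' k * b k - a k * b' k) - a k * b k) := by
  -- The formula is the limit l₂ → l of the mixed bracket in `row_row`. It satisfies its own
  -- recursion, so no limit is taken.
  induction k with
  | zero => simp [R.da_zero, R.b_zero, R.b'_zero]
  | succ k ih =>
    have hab := ih (by omega)
    obtain ⟨h1, h2, h3, h4⟩ := H.row_coord R (show k < n by omega)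
    obtain ⟨g1, g2, g3, g4⟩ := H.coord_row R k k le_rfl (show k < n by omega)
    rw [if_pos rfl] at g3
    have hpq := H.pq (j := k) (k := k) hk hk
    rw [if_pos rfl] at hpq
    simp only [R.da_succ, R.db_succ, R.b_succ, R.a_succ, R.a'_succ, R.b'_succ,
      map_sub, map_add, map_neg, map_smul, smul_eq_mul, LinearMap.sub_apply,
      LinearMap.add_apply, LinearMap.smul_apply, h1, h2, g1, g3, H.self, hpq,
      H.alt (db k) (da k)]
    linear_combination (x k * y k) * hab

/-- The brackets of the total momentum of the first `k` particles with the first row of their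
monodromy. -/
lemma TodaRelations.total_row (H : TodaRelations β s t n x y p dq dp)
    (R : RowJet x y p dq dp l a b a' b' da db) (k : ℕ) (hk : k ≤ n) :
    β (∑ i ∈ Finset.range k, dp i) (da k) = 0 ∧
    β (∑ i ∈ Finset.range k, dp i) (db k) =
      -(s * b k) - t * (l * b k + (if k = 0 then 0 else x (k - 1)) * a k) := by
  induction k with
  | zero => simp [R.b_zero]
  | succ k ih =>
    obtain ⟨ha, hb⟩ := ih (by omega)
    obtain ⟨g1, g2, g3, g4⟩ := H.coord_row R k k le_rfl (show k < n by omega)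
    rw [if_pos rfl] at g3
    have hpq := H.pq (j := k) (k := k) hk hk
    rw [if_pos rfl] at hpq
    have hq : β (∑ i ∈ Finset.range k, dp i) (dq k) = 0 := by
      rw [map_sum, LinearMap.sum_apply]
      refine Finset.sum_eq_zero fun i hi => ?_
      rw [Finset.mem_range] at hi
      rw [H.pq (by omega) hk, if_neg hi.ne]
    -- Among the earlier momenta only the neighbour p_{k-1} has a nonzero bracket with p_k.
    have hp : β (∑ i ∈ Finset.range k, dp i) (dp k)
        = -(t * y k * (if k = 0 then 0 else x (k - 1))) := by
      rw [map_sum, LinearMap.sum_apply]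
      cases k with
      | zero => simp
      | succ k =>
        rw [Finset.sum_range_succ, Finset.sum_eq_zero, H.alt, H.pp _ _ (Nat.lt_succ_self k) hk]
        · simp; ring
        · intro i hi
          rw [Finset.mem_range] at hi
          rw [H.alt, H.pp _ _ (by omega) hk, if_neg (by omega), neg_zero]
    simp only [Finset.sum_range_succ, R.da_succ, R.db_succ, R.b_succ, R.a_succ,
      map_sub, map_add, map_neg, map_smul, smul_eq_mul, LinearMap.add_apply, ha, hb, hq, hp, g3,
      g4, H.self, hpq, if_neg (Nat.succ_ne_zero k), Nat.add_sub_cancel]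
    constructor
    · ring
    · ring

/-- The brackets of the last position with the first row of the monodromy. -/
lemma TodaRelations.last_pos_row (H : TodaRelations β s t n x y p dq dp)
    (R : RowJet x y p dq dp l a b a' b' da db) (k : ℕ) (hk : k < n) :
    β (dq k) (da (k + 1)) = t * y k * b k - (s + t * p k) * a k ∧
    β (dq k) (db (k + 1)) = 0 := by
  obtain ⟨g1, g2, g3, g4⟩ := H.coord_row R k k le_rfl hk
  have hqp := H.qp k k hk hk
  rw [if_pos rfl] at hqp
  simp only [R.da_succ, R.db_succ, map_sub, map_add, map_neg, map_smul, smul_eq_mul, g1, g2,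
    H.self, hqp]
  constructor <;> ring

/-- The bracket of the total momentum with the last position. -/
lemma TodaRelations.total_last_pos (H : TodaRelations β s t n x y p dq dp) (k : ℕ) (hk : k < n) :
    β (∑ i ∈ Finset.range (k + 1), dp i) (dq k) = -(s + t * p k) := by
  rw [map_sum, LinearMap.sum_apply, Finset.sum_range_succ, Finset.sum_eq_zero, H.pq hk hk]
  · simp
  · intro i hi
    rw [Finset.mem_range] at hi
    rw [H.pq (by omega) hk, if_neg hi.ne]

end Algebra
end Toda

/-! ### Components of the two Poisson tensors and differentials of the monodromy row. -/

namespace Toda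

section Entries

variable {m : ℕ}

lemma wedgeVec_transpose {n : ℕ} (a b : Idx n) : (wedgeVec a b).transpose = -wedgeVec a b := by
  simp [wedgeVec]

lemma P_transpose (n : ℕ) (z : Phase n) : (P n z).transpose = -P n z := by
  simp [P, Matrix.transpose_sum, wedgeVec_transpose]

lemma P'_transpose (z : Phase (m + 1)) : (P' m z).transpose = -P' m z := by
  simp only [P', Matrix.transpose_add, Matrix.transpose_sum, Matrix.transpose_smul,
    wedgeVec_transpose, smul_neg, Finset.sum_neg_distrib, neg_add]

/-- `Matrix.J` has -1 in its upper right block, whence the sign. The identification makes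
`Matrix.symplecticGroup` available. -/
lemma P_eq_neg_J (n : ℕ) (z : Phase n) : P n z = -Matrix.J (Fin n) ℂ := by
  ext a b
  rcases a with i | i <;> rcases b with j | j <;>
    simp [P, wedgeVec, Matrix.sum_apply, Matrix.J, Matrix.single_apply, Matrix.one_apply,
      ite_and, eq_comm]

lemma P'_inl_inl (z : Phase (m + 1)) {j k : Fin (m + 1)} (h : k < j) :
    P' m z (Sum.inl j) (Sum.inl k) = 1 := by
  have h' : ¬ j < k := h.asymm
  simp [P', wedgeVec, Matrix.sum_apply, Matrix.single_apply, ite_and, h',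
    Finset.sum_sub_distrib]
  rw [Finset.sum_eq_single k (fun x _ hx => by simp [hx]) (by simp)]
  simp [h]

lemma P'_inl_inr (z : Phase (m + 1)) (j k : Fin (m + 1)) :
    P' m z (Sum.inl j) (Sum.inr k) = if j = k then (p z k : ℂ) else 0 := by
  simp [P', wedgeVec, Matrix.sum_apply, Matrix.single_apply, ite_and, eq_comm]
  split_ifs with h
  · rw [h]
  · rfl

lemma P'_inr_inr (z : Phase (m + 1)) {j k : Fin (m + 1)} (h : k < j) :
    P' m z (Sum.inr j) (Sum.inr k) =
      if (j : ℕ) = k + 1 then (Real.exp (q z k - q z j) : ℂ) else 0 := by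
  have h2 : ∀ i : Fin m, ¬ (i.castSucc = j ∧ i.succ = k) := by
    rintro i ⟨rfl, rfl⟩
    exact h.asymm (Fin.castSucc_lt_succ)
  have hmain : P' m z (Sum.inr j) (Sum.inr k) = ∑ i : Fin m,
      if i.succ = j ∧ i.castSucc = k then (Real.exp (q z i.castSucc - q z i.succ) : ℂ) else 0 := by
    simp [P', wedgeVec, Matrix.sum_apply, Matrix.single_apply, h2]
  rw [hmain]
  split_ifs with hjk
  · have hk : (k : ℕ) < m := by omega
    rw [Finset.sum_eq_single (⟨k, hk⟩ : Fin m)]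
    · have h3 : (⟨k, hk⟩ : Fin m).succ = j := by ext; simp [hjk]
      have h4 : (⟨k, hk⟩ : Fin m).castSucc = k := by ext; simp
      rw [if_pos ⟨h3, h4⟩, h3, h4]
    · rintro i - hi
      refine if_neg fun hc => hi ?_
      ext
      simp [← hc.2]
    · simp
  · refine Finset.sum_eq_zero fun i _ => if_neg ?_
    rintro ⟨rfl, rfl⟩
    simp at hjk

end Entries

section Relations

variable {m : ℕ}

/-- The differential of the `k`-th position. -/
def dpos (m : ℕ) (k : ℕ) : Idx (m + 1) → ℂ := Pi.single (Sum.inl (Fin.ofNat (m + 1) k)) 1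

/-- The differential of the `k`-th momentum. -/
def dmom (m : ℕ) (k : ℕ) : Idx (m + 1) → ℂ := Pi.single (Sum.inr (Fin.ofNat (m + 1) k)) 1

lemma bracket_eq {n : ℕ} (biv : Phase n → Matrix (Idx n) (Idx n) ℂ) (F G : Phase n → ℂ)
    (z : Phase n) :
    bracket biv F G z = Matrix.toBilin' (biv z) (differential F z) (differential G z) := by
  rw [Matrix.toBilin'_apply, bracket]
  refine Finset.sum_congr rfl fun a _ => Finset.sum_congr rfl fun b _ => by ring

lemma toBilin'_alt {n : ℕ} {M : Matrix (Idx n) (Idx n) ℂ} (hM : M.transpose = -M)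
    (v w : Idx n → ℂ) : Matrix.toBilin' M v w = -Matrix.toBilin' M w v := by
  simp only [Matrix.toBilin'_apply, ← Finset.sum_neg_distrib]
  rw [Finset.sum_comm]
  refine Finset.sum_congr rfl fun a _ => Finset.sum_congr rfl fun b _ => ?_
  have := congrFun (congrFun hM a) b
  simp only [Matrix.transpose_apply, Matrix.neg_apply] at this
  rw [this]
  ring

lemma val_ofNat {k : ℕ} (hk : k < m + 1) : ((Fin.ofNat (m + 1) k : Fin (m + 1)) : ℕ) = k := by
  simp [Nat.mod_eq_of_lt hk]

lemma ofNat_inj {j k : ℕ} (hj : j < m + 1) (hk : k < m + 1) :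
    Fin.ofNat (m + 1) j = Fin.ofNat (m + 1) k ↔ j = k := by
  rw [Fin.ext_iff, val_ofNat hj, val_ofNat hk]

lemma ofNat_lt {j k : ℕ} (hj : j < m + 1) (hk : k < m + 1) (h : j < k) :
    Fin.ofNat (m + 1) j < Fin.ofNat (m + 1) k := by
  rwa [Fin.lt_def, val_ofNat hj, val_ofNat hk]

lemma relations_P (z : Phase (m + 1)) :
    TodaRelations (Matrix.toBilin' (P (m + 1) z)) 1 0 (m + 1) (fun k => (Real.exp (pos z k) : ℂ))
      (fun k => (Real.exp (-pos z k) : ℂ)) (fun k => (mom z k : ℂ)) (dpos m) (dmom m) where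
  alt := toBilin'_alt (P_transpose _ z)
  qq j k _ _ := by
    rw [dpos, dpos, Matrix.toBilin'_single, P_eq_neg_J]; simp [Matrix.J]
  qp j k hj hk := by
    rw [dpos, dmom, Matrix.toBilin'_single, P_eq_neg_J]
    simp only [Matrix.J, Matrix.neg_apply, Matrix.fromBlocks_apply₁₂, Matrix.one_apply, neg_neg,
      ofNat_inj hj hk]
    simp
  pp j k _ _ := by
    rw [dmom, dmom, Matrix.toBilin'_single, P_eq_neg_J]; simp [Matrix.J]

lemma relations_P' (z : Phase (m + 1)) :
    TodaRelations (Matrix.toBilin' (P' m z)) 0 1 (m + 1) (fun k => (Real.exp (pos z k) : ℂ))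
      (fun k => (Real.exp (-pos z k) : ℂ)) (fun k => (mom z k : ℂ)) (dpos m) (dmom m) where
  alt := toBilin'_alt (P'_transpose z)
  qq j k hkj hj := by
    rw [dpos, dpos, Matrix.toBilin'_single, P'_inl_inl z (ofNat_lt (hkj.trans hj) hj hkj)]
  qp j k hj hk := by
    rw [dpos, dmom, Matrix.toBilin'_single, P'_inl_inr]
    simp only [ofNat_inj hj hk, zero_add, one_mul]
    rfl
  pp j k hkj hj := by
    rw [dmom, dmom, Matrix.toBilin'_single, P'_inr_inr z (ofNat_lt (hkj.trans hj) hj hkj),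
      val_ofNat hj, val_ofNat (hkj.trans hj), one_mul, ← Complex.ofReal_mul, ← Real.exp_add]
    rfl

end Relations

section Differential

variable {n : ℕ}

lemma differential_add {F G : Phase n → ℂ} {z : Phase n} (hF : DifferentiableAt ℝ F z)
    (hG : DifferentiableAt ℝ G z) :
    differential (fun w => F w + G w) z = differential F z + differential G z := by
  funext a; simp [differential, fderiv_fun_add hF hG]

lemma differential_sub {F G : Phase n → ℂ} {z : Phase n} (hF : DifferentiableAt ℝ F z)
    (hG : DifferentiableAt ℝ G z) :
    differential (fun w => F w - G w) z = differential F z - differential G z := by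
  funext a; simp [differential, fderiv_fun_sub hF hG]

lemma differential_neg (F : Phase n → ℂ) (z : Phase n) :
    differential (fun w => -F w) z = -differential F z := by
  funext a; simp [differential, fderiv_fun_neg]

lemma differential_const (c : ℂ) (z : Phase n) : differential (fun _ => c) z = 0 := by
  funext a; simp [differential]

lemma differential_sum {ι : Type*} (s : Finset ι) {F : ι → Phase n → ℂ} {z : Phase n}
    (hF : ∀ i ∈ s, DifferentiableAt ℝ (F i) z) :
    differential (fun w => ∑ i ∈ s, F i w) z = ∑ i ∈ s, differential (F i) z := by
  funext a; simp [differential, fderiv_fun_sum hF]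

lemma differential_mul {F G : Phase n → ℂ} {z : Phase n} (hF : DifferentiableAt ℝ F z)
    (hG : DifferentiableAt ℝ G z) :
    differential (fun w => F w * G w) z = F z • differential G z + G z • differential F z := by
  funext a; simp [differential, fderiv_fun_mul hF hG]

lemma differential_cexp {F : Phase n → ℂ} {z : Phase n} (hF : DifferentiableAt ℝ F z) :
    differential (fun w => Complex.exp (F w)) z = Complex.exp (F z) • differential F z := by
  funext a; simp [differential, hF.hasFDerivAt.cexp.fderiv]

lemma differential_congr {F G : Phase n → ℂ} {z : Phase n} (h : F =ᶠ[nhds z] G) :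
    differential F z = differential G z := by
  funext a; simp [differential, h.fderiv_eq]

lemma differentiable_coord (a : Idx n) : Differentiable ℝ fun z : Phase n => (z a : ℂ) := by
  fun_prop

lemma differential_coord (a : Idx n) (z : Phase n) :
    differential (fun w => (w a : ℂ)) z = Pi.single a 1 := by
  have h : HasFDerivAt (fun w : Phase n => (w a : ℂ))
      (Complex.ofRealCLM.comp (ContinuousLinearMap.proj a)) z :=
    (Complex.ofRealCLM.comp (ContinuousLinearMap.proj a : Phase n →L[ℝ] ℝ)).hasFDerivAt
  funext b
  by_cases hb : b = a
  · subst hb; simp [differential, h.fderiv]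
  · simp [differential, h.fderiv, hb, Ne.symm hb]

end Differential

section RowDifferential

open Polynomial

variable {m : ℕ}

lemma aeval_rowA_succ (z : Phase (m + 1)) (k : ℕ) (l : ℂ) :
    aeval l (rowA z (k + 1)) = (l - (mom z k : ℂ)) * aeval l (rowA z k)
      + Complex.exp (-(pos z k : ℂ)) * aeval l (rowB z k) := by
  simp [rowA_succ]

lemma aeval_rowB_succ (z : Phase (m + 1)) (k : ℕ) (l : ℂ) :
    aeval l (rowB z (k + 1)) = -(Complex.exp (pos z k : ℂ) * aeval l (rowA z k)) := by
  simp [rowB_succ]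

/-- Smoothness is needed jointly in the phase point and λ, because λ will be replaced by functions
of the phase point. -/
lemma contDiff_row (k : ℕ) :
    (ContDiff ℝ ∞ fun w : Phase (m + 1) × ℂ => aeval w.2 (rowA w.1 k)) ∧
    (ContDiff ℝ ∞ fun w : Phase (m + 1) × ℂ => aeval w.2 (rowB w.1 k)) := by
  have hpos : ∀ k, ContDiff ℝ ∞ fun w : Phase (m + 1) × ℂ => (pos w.1 k : ℂ) := fun k =>
    Complex.ofRealCLM.contDiff.comp ((contDiff_apply ℝ ℝ _).comp contDiff_fst)
  have hmom : ∀ k, ContDiff ℝ ∞ fun w : Phase (m + 1) × ℂ => (mom w.1 k : ℂ) := fun k =>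
    Complex.ofRealCLM.contDiff.comp ((contDiff_apply ℝ ℝ _).comp contDiff_fst)
  induction k with
  | zero => simpa using ⟨contDiff_const, contDiff_const⟩
  | succ k ih =>
    simp only [aeval_rowA_succ, aeval_rowB_succ]
    exact ⟨((contDiff_snd.sub (hmom k)).mul ih.1).add ((hpos k).neg.cexp.mul ih.2),
      ((hpos k).cexp.mul ih.1).neg⟩

lemma contDiff_rowA (k : ℕ) :
    ContDiff ℝ ∞ fun w : Phase (m + 1) × ℂ => aeval w.2 (rowA w.1 k) := (contDiff_row k).1

lemma contDiff_rowB (k : ℕ) :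
    ContDiff ℝ ∞ fun w : Phase (m + 1) × ℂ => aeval w.2 (rowB w.1 k) := (contDiff_row k).2

lemma differentiable_aeval_rowA (l : ℂ) (k : ℕ) :
    Differentiable ℝ fun z : Phase (m + 1) => aeval l (rowA z k) :=
  ((contDiff_rowA k).comp (contDiff_prodMk_left l)).differentiable (by simp)

lemma differentiable_aeval_rowB (l : ℂ) (k : ℕ) :
    Differentiable ℝ fun z : Phase (m + 1) => aeval l (rowB z k) :=
  ((contDiff_rowB k).comp (contDiff_prodMk_left l)).differentiable (by simp)

/-- The differentials are taken at fixed λ = l. The dependence of a root on the phase point enters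
separately, through `differential_comp_prod`. -/
lemma rowJet (z : Phase (m + 1)) (l : ℂ) :
    RowJet (fun k => (Real.exp (pos z k) : ℂ)) (fun k => (Real.exp (-pos z k) : ℂ))
      (fun k => (mom z k : ℂ)) (dpos m) (dmom m) l
      (fun k => aeval l (rowA z k)) (fun k => aeval l (rowB z k))
      (fun k => aeval l (derivative (rowA z k))) (fun k => aeval l (derivative (rowB z k)))
      (fun k => differential (fun w => aeval l (rowA w k)) z)
      (fun k => differential (fun w => aeval l (rowB w k)) z) where
  a_zero := by simp
  b_zero := by simp
  a'_zero := by simp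
  b'_zero := by simp
  da_zero := by simp [differential_const]
  db_zero := by simp [differential_const]
  a_succ k := by simp [aeval_rowA_succ]
  b_succ k := by simp [aeval_rowB_succ]
  a'_succ k := by simp [rowA_succ]
  b'_succ k := by simp [rowB_succ]
  da_succ k := by
    have hp : Differentiable ℝ fun w : Phase (m + 1) => (pos w k : ℂ) := differentiable_coord _
    have hm : Differentiable ℝ fun w : Phase (m + 1) => (mom w k : ℂ) := differentiable_coord _
    have hA := differentiable_aeval_rowA (m := m) l k
    have hB := differentiable_aeval_rowB (m := m) l k
    have dp : differential (fun w : Phase (m + 1) => (pos w k : ℂ)) z = dpos m k :=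
      differential_coord _ z
    have dm : differential (fun w : Phase (m + 1) => (mom w k : ℂ)) z = dmom m k :=
      differential_coord _ z
    simp only [aeval_rowA_succ]
    have hl : Differentiable ℝ fun w : Phase (m + 1) => l - (mom w k : ℂ) := hm.const_sub l
    have he : Differentiable ℝ fun w : Phase (m + 1) => Complex.exp (-(pos w k : ℂ)) :=
      hp.fun_neg.cexp
    rw [differential_add ((hl.fun_mul hA) z) ((he.fun_mul hB) z), differential_mul (hl z) (hA z),
      differential_mul (he z) (hB z), differential_sub (differentiableAt_const l) (hm z),
      differential_const, differential_cexp (hp.fun_neg z), differential_neg, dp, dm]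
    push_cast
    module
  db_succ k := by
    have hp : Differentiable ℝ fun w : Phase (m + 1) => (pos w k : ℂ) := differentiable_coord _
    have hA := differentiable_aeval_rowA (m := m) l k
    have dp : differential (fun w : Phase (m + 1) => (pos w k : ℂ)) z = dpos m k :=
      differential_coord _ z
    simp only [aeval_rowB_succ]
    rw [differential_neg, differential_mul (hp.cexp z) (hA z), differential_cexp (hp z), dp]
    push_cast
    module

end RowDifferential

end Toda

/-! ### Sklyanin variables: smoothness, differentials and separation of points. -/

namespace Toda

open Polynomial

section Implicit

variable {n : ℕ}

/-- G is only real differentiable, but holomorphic in its second argument: there the real derivative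
is multiplication by c, invertible over ℝ as soon as c ≠ 0. -/
lemma fderiv_comp_inr {G : Phase n × ℂ → ℂ} {z : Phase n} {l c : ℂ}
    (hG : DifferentiableAt ℝ G (z, l)) (hc : HasDerivAt (fun l => G (z, l)) c l) (w : ℂ) :
    fderiv ℝ G (z, l) (0, w) = w * c := by
  have h1 : HasFDerivAt (fun l => G (z, l))
      ((fderiv ℝ G (z, l)).comp (ContinuousLinearMap.inr ℝ (Phase n) ℂ)) l :=
    HasFDerivAt.comp l (f := fun l => (z, l)) hG.hasFDerivAt (hasFDerivAt_prodMk_right z l)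
  have h2 := h1.unique (hc.hasFDerivAt.restrictScalars ℝ)
  simpa using congrArg (fun T : ℂ →L[ℝ] ℂ => T w) h2

/-- Continuity keeps f near f z, where the implicit function is the only solution. The two therefore
agree locally and f inherits smoothness. -/
lemma contDiffAt_of_implicit {G : Phase n × ℂ → ℂ} {f : Phase n → ℂ} {z : Phase n} {c : ℂ}
    (hG : ContDiffAt ℝ ∞ G (z, f z)) (hf : ContinuousAt f z)
    (h0 : ∀ᶠ w in nhds z, G (w, f w) = 0)
    (hc : HasDerivAt (fun l => G (z, l)) c (f z)) (hc0 : c ≠ 0) : ContDiffAt ℝ ∞ f z := by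
  have hn : (∞ : WithTop ℕ∞) ≠ 0 := by simp
  have hd := hG.differentiableAt hn
  have hinv : (fderiv ℝ G (z, f z) ∘L .inr ℝ (Phase n) ℂ).IsInvertible := by
    refine ContinuousLinearMap.IsInvertible.of_inverse
      (g := (ContinuousLinearMap.toSpanSingleton ℂ c⁻¹).restrictScalars ℝ) ?_ ?_
    · refine ContinuousLinearMap.ext fun w => ?_
      simp [fderiv_comp_inr hd hc, hc0]
    · refine ContinuousLinearMap.ext fun w => ?_
      simp [fderiv_comp_inr hd hc, hc0]
  have hev : ∀ᶠ w in nhds z, G (w, f w) = G (z, f z) ↔ hG.implicitFunction hn hinv w = f w :=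
    (continuousAt_id.prodMk hf).eventually
      (hG.eventually_apply_eq_iff_implicitFunction hn hinv)
  refine (hG.contDiffAt_implicitFunction hn hinv).congr_of_eventuallyEq ?_
  filter_upwards [hev, h0] with w hw hw0
  exact (hw.1 (hw0.trans h0.self_of_nhds.symm)).symm

lemma differential_comp_prod {G : Phase n × ℂ → ℂ} {f : Phase n → ℂ} {z : Phase n} {c : ℂ}
    (hG : DifferentiableAt ℝ G (z, f z)) (hf : DifferentiableAt ℝ f z)
    (hc : HasDerivAt (fun l => G (z, l)) c (f z)) :
    differential (fun w => G (w, f w)) z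
      = differential (fun w => G (w, f z)) z + c • differential f z := by
  have h1 : HasFDerivAt (fun w => G (w, f z))
      ((fderiv ℝ G (z, f z)).comp (ContinuousLinearMap.inl ℝ (Phase n) ℂ)) z :=
    HasFDerivAt.comp z (f := fun w => (w, f z)) hG.hasFDerivAt (hasFDerivAt_prodMk_left z (f z))
  have h2 : HasFDerivAt (fun w => G (w, f w))
      ((fderiv ℝ G (z, f z)).comp ((ContinuousLinearMap.id ℝ (Phase n)).prod (fderiv ℝ f z))) z :=
    HasFDerivAt.comp z (f := fun w => (w, f w)) hG.hasFDerivAt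
      ((hasFDerivAt_id z).prodMk hf.hasFDerivAt)
  funext a
  have hsplit : ((Pi.single a 1 : Phase n), fderiv ℝ f z (Pi.single a 1))
      = (Pi.single a 1, 0) + (0, fderiv ℝ f z (Pi.single a 1)) := by simp
  simp only [differential, h1.fderiv, h2.fderiv, Pi.add_apply, Pi.smul_apply, smul_eq_mul,
    ContinuousLinearMap.comp_apply, ContinuousLinearMap.prod_apply, ContinuousLinearMap.inl_apply,
    ContinuousLinearMap.id_apply]
  rw [hsplit, map_add, fderiv_comp_inr hG hc, mul_comm c]

end Implicit

section Monodromy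

variable {m : ℕ}

lemma ofNat_self : Fin.ofNat (m + 1) m = Fin.last m := by
  ext; simp

lemma eval_polyA (z : Phase (m + 1)) (l : ℂ) : (polyA z).eval l = aeval l (rowA z (m + 1)) := by
  rw [polyA_eq]; exact eval_map_algebraMap _ _

lemma eval_polyB (z : Phase (m + 1)) (l : ℂ) : (polyB z).eval l = aeval l (rowB z (m + 1)) := by
  rw [polyB_eq]; exact eval_map_algebraMap _ _

lemma eval_derivative_polyA (z : Phase (m + 1)) (l : ℂ) :
    (derivative (polyA z)).eval l = aeval l (derivative (rowA z (m + 1))) := by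
  rw [polyA_eq, derivative_map]; exact eval_map_algebraMap _ _

lemma eval_derivative_polyB (z : Phase (m + 1)) (l : ℂ) :
    (derivative (polyB z)).eval l = aeval l (derivative (rowB z (m + 1))) := by
  rw [polyB_eq, derivative_map]; exact eval_map_algebraMap _ _

/-- Up to a nonzero constant, B is the A-polynomial of the chain without its last particle. Its
roots are therefore those of a monic polynomial of degree n - 1. -/
lemma polyB_eq_mul (z : Phase (m + 1)) :
    polyB z = -C (Real.exp (pos z m) : ℂ) * (rowA z m).map Complex.ofRealHom := by
  rw [polyB_eq, rowB_succ]; simp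

lemma polyB_ne_zero (z : Phase (m + 1)) : polyB z ≠ 0 := by
  rw [polyB_eq]
  exact (Polynomial.map_ne_zero_iff Complex.ofRealHom.injective).2 (rowB_succ_ne_zero z m)

lemma roots_polyB (z : Phase (m + 1)) :
    (polyB z).roots = ((rowA z m).map Complex.ofRealHom).roots := by
  rw [polyB_eq_mul, ← C_neg, roots_C_mul]
  simp

lemma map_rowA_eq_prod (z : Phase (m + 1)) :
    (rowA z m).map Complex.ofRealHom = ((polyB z).roots.map fun a => X - C a).prod := by
  rw [roots_polyB]
  exact (IsAlgClosed.splits _).eq_prod_roots_of_monic ((rowA_monic z m).map _)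

lemma card_roots_polyB (z : Phase (m + 1)) : (polyB z).roots.card = m := by
  rw [roots_polyB, ← (IsAlgClosed.splits _).natDegree_eq_card_roots,
    (rowA_monic z m).natDegree_map, natDegree_rowA]

lemma aeval_rowB_of_mem {z : Phase (m + 1)} {l : ℂ} (h : l ∈ (polyB z).roots) :
    aeval l (rowB z (m + 1)) = 0 := by
  rw [← eval_polyB]; exact (mem_roots'.1 h).2

lemma nodup_roots_polyB (z : Phase (m + 1)) : (polyB z).roots.Nodup := by
  rw [Multiset.nodup_iff_count_le_one]
  intro l
  rw [count_roots]
  by_contra! h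
  have h2 := (one_lt_rootMultiplicity_iff_isRoot (polyB_ne_zero z)).1 h
  have hB : aeval l (rowB z (m + 1)) = 0 := by rw [← eval_polyB]; exact h2.1
  have hB' : aeval l (derivative (rowB z (m + 1))) = 0 := by
    rw [← eval_derivative_polyB]; exact h2.2
  exact aeval_wronskian_ne_zero z m hB (by rw [hB', mul_zero])

lemma hasDerivAt_rowA (z : Phase (m + 1)) (k : ℕ) (l : ℂ) :
    HasDerivAt (fun l : ℂ => aeval (z, l).2 (rowA (z, l).1 k))
      (aeval l (derivative (rowA z k))) l :=
  Polynomial.hasDerivAt_aeval (rowA z k) l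

lemma hasDerivAt_rowB (z : Phase (m + 1)) (k : ℕ) (l : ℂ) :
    HasDerivAt (fun l : ℂ => aeval (z, l).2 (rowB (z, l).1 k))
      (aeval l (derivative (rowB z k))) l :=
  Polynomial.hasDerivAt_aeval (rowB z k) l

end Monodromy

namespace IsSklyanin

variable {m : ℕ} {U : Set (Phase (m + 1))} {u v : Fin (m + 1) → Phase (m + 1) → ℂ}
  {z : Phase (m + 1)}

lemma mem_roots (hS : IsSklyanin U u v) (hz : z ∈ U) (j : Fin m) :
    u j.castSucc z ∈ (polyB z).roots := by
  rw [hS.roots_B z hz]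
  exact Multiset.mem_map_of_mem _ (Finset.mem_univ j)

lemma aeval_rowB (hS : IsSklyanin U u v) (hz : z ∈ U) (j : Fin m) :
    aeval (u j.castSucc z) (rowB z (m + 1)) = 0 := aeval_rowB_of_mem (hS.mem_roots hz j)

lemma aeval_derivative_rowB_ne_zero (hS : IsSklyanin U u v) (hz : z ∈ U) (j : Fin m) :
    aeval (u j.castSucc z) (derivative (rowB z (m + 1))) ≠ 0 :=
  right_ne_zero_of_mul (aeval_wronskian_ne_zero z m (hS.aeval_rowB hz j))

lemma aeval_rowA (hS : IsSklyanin U u v) (hz : z ∈ U) (j : Fin m) :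
    aeval (u j.castSucc z) (rowA z (m + 1)) = Complex.exp (-v j.castSucc z) := by
  rw [hS.exp_neg_v z hz, eval_polyA]

lemma exp_last (hS : IsSklyanin U u v) (hz : z ∈ U) :
    Complex.exp (-v (Fin.last m) z) = (Real.exp (pos z m) : ℂ) := by
  rw [hS.v_last z hz, neg_neg, Complex.ofReal_exp, pos, ofNat_self]; rfl

lemma injective (hS : IsSklyanin U u v) (hz : z ∈ U) :
    Function.Injective fun j : Fin m => u j.castSucc z := by
  have h := nodup_roots_polyB z
  rw [hS.roots_B z hz] at h
  intro i j hij
  exact Multiset.inj_on_of_nodup_map h i (Finset.mem_univ i) j (Finset.mem_univ j) hij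

lemma map_rowA (hS : IsSklyanin U u v) (hz : z ∈ U) :
    (rowA z m).map Complex.ofRealHom = ∏ j : Fin m, (X - C (u j.castSucc z)) := by
  rw [map_rowA_eq_prod, hS.roots_B z hz, Multiset.map_map]
  rfl

lemma polyB_eq (hS : IsSklyanin U u v) (hz : z ∈ U) :
    polyB z = -C (Complex.exp (-v (Fin.last m) z)) *
      ∏ j : Fin m, (X - C (u j.castSucc z)) := by
  rw [polyB_eq_mul, hS.map_rowA hz, hS.exp_last hz]

lemma im_u (hS : IsSklyanin U u v) (hz : z ∈ U) (i : Fin (m + 1)) : (u i z).im = 0 := by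
  induction i using Fin.lastCases with
  | last => rw [hS.u_last z hz]; simp
  | cast j => exact im_eq_zero_of_aeval_rowB z m (hS.aeval_rowB hz j)

lemma im_v (hS : IsSklyanin U u v) (hz : z ∈ U) (i : Fin (m + 1)) :
    ∃ k : ℤ, (v i z).im = k * Real.pi := by
  induction i using Fin.lastCases with
  | last => exact ⟨0, by rw [hS.v_last z hz]; simp⟩
  | cast j =>
    have h := congrArg Complex.im (hS.aeval_rowA hz j)
    obtain ⟨t, ht⟩ : ∃ t : ℝ, u j.castSucc z = t :=
      ⟨(u j.castSucc z).re, by apply Complex.ext <;> simp [hS.im_u hz]⟩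
    have key : aeval (t : ℂ) (rowA z (m + 1)) = (((rowA z (m + 1)).eval t : ℝ) : ℂ) := by
      simpa using aeval_algebraMap_apply_eq_algebraMap_eval (A := ℂ) t (rowA z (m + 1))
    rw [ht, key, Complex.ofReal_im, Complex.exp_im, eq_comm, mul_eq_zero,
      or_iff_right (Real.exp_pos _).ne', Complex.neg_im, Real.sin_neg, neg_eq_zero,
      Real.sin_eq_zero_iff] at h
    obtain ⟨k, hk⟩ := h
    exact ⟨k, hk.symm⟩

lemma eval_derivative_polyB (hS : IsSklyanin U u v) (hz : z ∈ U) (i : Fin m) :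
    aeval (u i.castSucc z) (derivative (rowB z (m + 1)))
      = -Complex.exp (-v (Fin.last m) z) *
        ∏ j ∈ Finset.univ.erase i, (u i.castSucc z - u j.castSucc z) := by
  rw [← Toda.eval_derivative_polyB, hS.polyB_eq hz, ← C_neg, derivative_C_mul,
    derivative_prod_finset, eval_C_mul, eval_finsetSum, Finset.sum_eq_single i]
  · simp [eval_prod]
  · intro k _ hk
    rw [eval_mul, eval_prod, Finset.prod_eq_zero (Finset.mem_erase.2 ⟨hk.symm, Finset.mem_univ i⟩)]
    · simp
    · simp
  · simp

/-- By Vieta the roots of A_{n-1} sum to p_1 + ⋯ + p_{n-1}, which leaves p_n. -/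
lemma sCoef_eq (hS : IsSklyanin U u v) (hz : z ∈ U) : sCoef u z = (mom z m : ℂ) := by
  have hsum : ∑ i, (p z i : ℂ) = ∑ i ∈ Finset.range (m + 1), (mom z i : ℂ) := by
    rw [← Fin.sum_univ_eq_sum_range]
    refine Finset.sum_congr rfl fun i _ => ?_
    simp [mom, p]
  have hroots : ∑ j : Fin m, u j.castSucc z = ∑ i ∈ Finset.range m, (mom z i : ℂ) := by
    cases m with
    | zero => simp
    | succ m =>
      have h := congrArg (fun f => f.coeff m) (hS.map_rowA hz)
      have h2 := prod_X_sub_C_coeff_card_pred (Finset.univ : Finset (Fin (m + 1)))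
        (fun j => u j.castSucc z) (by simp)
      simp only [Finset.card_univ, Fintype.card_fin, Nat.add_sub_cancel] at h2
      simp only [h2, coeff_map, coeff_rowA_succ] at h
      simpa using h.symm
  rw [sCoef, hS.u_last z hz, hsum, hroots, Finset.sum_range_succ]
  ring

lemma contDiffAt_u (hU : IsOpen U) (hS : IsSklyanin U u v) (hz : z ∈ U) (j : Fin m) :
    ContDiffAt ℝ ∞ (u j.castSucc) z :=
  contDiffAt_of_implicit (contDiff_rowB (m + 1)).contDiffAt
    ((hS.continuousOn_u j).continuousAt (hU.mem_nhds hz))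
    (Filter.mem_of_superset (hU.mem_nhds hz) fun _ hw => hS.aeval_rowB hw j)
    (hasDerivAt_rowB z _ _) (hS.aeval_derivative_rowB_ne_zero hz j)

/-- The equation e^{-v} = A(u) has nonvanishing derivative in v, so the implicit function theorem
treats every continuous branch of the logarithm alike. -/
lemma contDiffAt_v (hU : IsOpen U) (hS : IsSklyanin U u v) (hz : z ∈ U) (j : Fin m) :
    ContDiffAt ℝ ∞ (v j.castSucc) z := by
  have hA : ContDiffAt ℝ ∞ (fun w : Phase (m + 1) × ℂ =>
      Complex.exp (-w.2) - aeval (u j.castSucc w.1) (rowA w.1 (m + 1))) (z, v j.castSucc z) := by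
    refine contDiffAt_snd.neg.cexp.sub ?_
    exact (contDiff_rowA (m + 1)).contDiffAt.comp _
      (contDiffAt_fst.prodMk ((hS.contDiffAt_u hU hz j).comp _ contDiffAt_fst))
  refine contDiffAt_of_implicit hA ((hS.continuousOn_v j).continuousAt (hU.mem_nhds hz))
    (Filter.mem_of_superset (hU.mem_nhds hz) fun w hw => ?_)
    (c := Complex.exp (-v j.castSucc z) * -1)
    (HasDerivAt.sub_const (aeval (u j.castSucc z) (rowA z (m + 1)))
      (hasDerivAt_neg (v j.castSucc z)).cexp) (by simp)
  simp [hS.aeval_rowA hw]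

/-- Differentiate B(u_j) = 0: the differential at fixed λ plus B'(u_j) du_j vanishes. -/
lemma differential_u (hU : IsOpen U) (hS : IsSklyanin U u v) (hz : z ∈ U) (j : Fin m) :
    differential (u j.castSucc) z
      = -((aeval (u j.castSucc z) (derivative (rowB z (m + 1))))⁻¹ •
        differential (fun w => aeval (u j.castSucc z) (rowB w (m + 1))) z) := by
  have h := differential_comp_prod (z := z) (f := u j.castSucc)
    ((contDiff_rowB (m + 1)).contDiffAt.differentiableAt (by simp))
    ((hS.contDiffAt_u hU hz j).differentiableAt (by simp)) (hasDerivAt_rowB z _ _)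
  have h0 : differential (fun w => aeval (u j.castSucc w) (rowB w (m + 1))) z = 0 := by
    rw [← differential_const 0 z]
    exact differential_congr
      (Filter.mem_of_superset (hU.mem_nhds hz) fun _ hw => hS.aeval_rowB hw j)
  rw [h0, eq_comm, add_eq_zero_iff_eq_neg'] at h
  rw [← smul_neg, ← neg_eq_iff_eq_neg.2 h, neg_neg,
    inv_smul_smul₀ (hS.aeval_derivative_rowB_ne_zero hz j)]

lemma differential_v (hU : IsOpen U) (hS : IsSklyanin U u v) (hz : z ∈ U) (j : Fin m) :
    differential (v j.castSucc) z
      = -((aeval (u j.castSucc z) (rowA z (m + 1)))⁻¹ •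
        (differential (fun w => aeval (u j.castSucc z) (rowA w (m + 1))) z
          + aeval (u j.castSucc z) (derivative (rowA z (m + 1))) •
            differential (u j.castSucc) z)) := by
  have h := differential_comp_prod (z := z) (f := u j.castSucc)
    ((contDiff_rowA (m + 1)).contDiffAt.differentiableAt (by simp))
    ((hS.contDiffAt_u hU hz j).differentiableAt (by simp)) (hasDerivAt_rowA z _ _)
  have hv := (hS.contDiffAt_v hU hz j).differentiableAt (by simp)
  have h0 : differential (fun w => aeval (u j.castSucc w) (rowA w (m + 1))) z
      = Complex.exp (-v j.castSucc z) • -differential (v j.castSucc) z := by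
    rw [← differential_neg, ← differential_cexp hv.fun_neg]
    exact differential_congr
      (Filter.mem_of_superset (hU.mem_nhds hz) fun _ hw => hS.aeval_rowA hw j)
  rw [← h, h0, hS.aeval_rowA hz, inv_smul_smul₀ (Complex.exp_ne_zero _), neg_neg]

lemma contDiffOn (hU : IsOpen U) (hS : IsSklyanin U u v) (a : Idx (m + 1)) :
    ContDiffOn ℝ ∞ (pair u v a) U := by
  have hcoord : ∀ a : Idx (m + 1), ContDiff ℝ ∞ fun w : Phase (m + 1) => (w a : ℂ) := fun a =>
    Complex.ofRealCLM.contDiff.comp (contDiff_apply ℝ ℝ a)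
  rcases a with i | i <;> induction i using Fin.lastCases with
  | last =>
    first
    | exact ContDiff.contDiffOn (ContDiff.sum fun i _ => hcoord (Sum.inr i)) |>.congr hS.u_last
    | exact ContDiff.contDiffOn (hcoord _).neg |>.congr hS.v_last
  | cast j =>
    first
    | exact fun z hz => (hS.contDiffAt_u hU hz j).contDiffWithinAt
    | exact fun z hz => (hS.contDiffAt_v hU hz j).contDiffWithinAt

lemma differential_u_last (hU : IsOpen U) (hS : IsSklyanin U u v) (hz : z ∈ U) :
    differential (u (Fin.last m)) z = ∑ i ∈ Finset.range (m + 1), dmom m i := by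
  have h : u (Fin.last m) =ᶠ[nhds z] fun w => ∑ i, (p w i : ℂ) :=
    Filter.mem_of_superset (hU.mem_nhds hz) hS.u_last
  have hsum := differential_sum (z := z) Finset.univ
    fun (i : Fin (m + 1)) _ => differentiable_coord (Sum.inr i) z
  rw [differential_congr h, show differential (fun w => ∑ i, (p w i : ℂ)) z = _ from hsum,
    ← Fin.sum_univ_eq_sum_range]
  refine Finset.sum_congr rfl fun i _ => ?_
  exact (differential_coord (Sum.inr i) z).trans (by simp [dmom])

lemma differential_v_last (hU : IsOpen U) (hS : IsSklyanin U u v) (hz : z ∈ U) :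
    differential (v (Fin.last m)) z = -dpos m m := by
  have h : v (Fin.last m) =ᶠ[nhds z] fun w => -(q w (Fin.last m) : ℂ) :=
    Filter.mem_of_superset (hU.mem_nhds hz) hS.v_last
  rw [differential_congr h, differential_neg, dpos, ofNat_self]
  exact congrArg _ (differential_coord (Sum.inl (Fin.last m)) z)

/-- The roots and v_n give B. A is monic of degree n, its subleading coefficient is fixed by the
u_i, and its values e^{-v_j} at n - 1 distinct nodes fix the rest. The pair (A, B) then determines
the phase point. -/
lemma injOn (hS : IsSklyanin U u v) : Set.InjOn (fun z a => pair u v a z) U := by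
  intro z hz w hw h
  have hu : ∀ i, u i z = u i w := fun i => congrFun h (Sum.inl i)
  have hv : ∀ i, v i z = v i w := fun i => congrFun h (Sum.inr i)
  have hB : rowB z (m + 1) = rowB w (m + 1) := by
    refine Polynomial.map_injective _ Complex.ofRealHom.injective ?_
    rw [← Toda.polyB_eq, ← Toda.polyB_eq, hS.polyB_eq hz, hS.polyB_eq hw]
    simp only [hu, hv]
  have hA : rowA z (m + 1) = rowA w (m + 1) := by
    have hsum : (rowA z (m + 1)).coeff m = (rowA w (m + 1)).coeff m := by
      have h1 := hS.sCoef_eq hz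
      have h2 := hS.sCoef_eq hw
      have h3 := hS.map_rowA hz
      have h4 := hS.map_rowA hw
      have hs : sCoef u z = sCoef u w := by simp only [sCoef, hu]
      have hp : mom z m = mom w m := by
        rw [hs, h2] at h1; exact_mod_cast h1.symm
      have hr : rowA z m = rowA w m := by
        refine Polynomial.map_injective _ Complex.ofRealHom.injective ?_
        rw [h3, h4]; simp only [hu]
      rw [coeff_rowA_succ, coeff_rowA_succ, Finset.sum_range_succ, Finset.sum_range_succ, hp]
      cases m with
      | zero => simp
      | succ m =>
        have := congrArg (fun f => f.coeff m) hr
        simp only [coeff_rowA_succ] at this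
        linarith
    by_contra hne
    set d := rowA z (m + 1) - rowA w (m + 1) with hd
    have hd0 : d ≠ 0 := sub_ne_zero.2 hne
    -- The two top coefficients agree, so the difference has degree below m and yet vanishes at m
    -- distinct nodes.
    have hdeg : d.natDegree < m := by
      have hlt : d.degree < ((m + 1 : ℕ) : WithBot ℕ) := by
        rw [← degree_rowA z (m + 1)]
        exact degree_sub_lt_left (by rw [degree_rowA, degree_rowA]) (rowA_monic z _).ne_zero
          (by rw [(rowA_monic z _).leadingCoeff, (rowA_monic w _).leadingCoeff])
      rw [← natDegree_lt_iff_degree_lt hd0] at hlt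
      refine lt_of_le_of_ne (Nat.lt_succ_iff.1 hlt) fun he => hd0 ?_
      rw [← leadingCoeff_eq_zero, leadingCoeff, he, hd, coeff_sub, hsum, sub_self]
    have hroot : ∀ j : Fin m, (d.map Complex.ofRealHom).eval (u j.castSucc z) = 0 := by
      intro j
      have h1 : (d.map Complex.ofRealHom).eval (u j.castSucc z) = aeval (u j.castSucc z) d :=
        eval_map_algebraMap _ _
      rw [h1, hd, map_sub, hS.aeval_rowA hz, hu j.castSucc, hS.aeval_rowA hw, hv, sub_self]
    have hz0 := Polynomial.eq_zero_of_natDegree_lt_card_of_eval_eq_zero (d.map Complex.ofRealHom)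
      (hS.injective hz) hroot (by
        rw [natDegree_map_eq_of_injective Complex.ofRealHom.injective, Fintype.card_fin]
        exact hdeg)
    exact hd0 ((Polynomial.map_eq_zero_iff Complex.ofRealHom.injective).1 hz0)
  have key := eq_of_rowA_rowB_eq z w (m + 1) hA hB
  funext a
  rcases a with i | i
  · simpa [pos] using (key i i.2).1
  · simpa [mom] using (key i i.2).2

end IsSklyanin

end Toda

/-! ### Brackets of Sklyanin variables, symplectic Jacobian and dual frame. -/

namespace Toda

open Polynomial

namespace IsSklyanin

variable {m : ℕ} {U : Set (Phase (m + 1))} {u v : Fin (m + 1) → Phase (m + 1) → ℂ}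
  {z : Phase (m + 1)} {β : LinearMap.BilinForm ℂ (Idx (m + 1) → ℂ)} {s t : ℂ}

/-- The hypothesis that `β` is a combination of the two brackets at `z`. -/
abbrev Relations (β : LinearMap.BilinForm ℂ (Idx (m + 1) → ℂ)) (s t : ℂ)
    (z : Phase (m + 1)) : Prop :=
  TodaRelations β s t (m + 1) (fun k => (Real.exp (pos z k) : ℂ))
      (fun k => (Real.exp (-pos z k) : ℂ)) (fun k => (mom z k : ℂ)) (dpos m) (dmom m)

/-- At zeros of B every term of the quadratic bracket carries a vanishing factor, except A B' at
coinciding points. -/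
lemma form_B_A (hS : IsSklyanin U u v) (hz : z ∈ U) (H : Relations β s t z) (i j : Fin m) :
    β (differential (fun w => aeval (u i.castSucc z) (rowB w (m + 1))) z)
      (differential (fun w => aeval (u j.castSucc z) (rowA w (m + 1))) z)
      = if i = j then (s + t * u i.castSucc z) * (aeval (u i.castSucc z) (rowA z (m + 1)) *
        aeval (u i.castSucc z) (derivative (rowB z (m + 1)))) else 0 := by
  split_ifs with hij
  · subst hij
    have h := H.row_row_self (rowJet z (u i.castSucc z)) (m + 1) le_rfl
    rw [H.alt, h, hS.aeval_rowB hz]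
    ring
  · have hne : u i.castSucc z ≠ u j.castSucc z := fun h => hij (hS.injective hz h)
    have h := (H.row_row (rowJet z (u i.castSucc z)) (rowJet z (u j.castSucc z)) hne (m + 1)
      le_rfl).2.2.2
    simp only [hS.aeval_rowB hz, mul_zero, sub_zero, add_zero] at h
    exact (mul_eq_zero.1 h).resolve_left (sub_ne_zero.2 hne)

lemma form_u_u (hU : IsOpen U) (hS : IsSklyanin U u v) (hz : z ∈ U) (H : Relations β s t z)
    (i j : Fin m) :
    β (differential (u i.castSucc) z) (differential (u j.castSucc) z) = 0 := by
  by_cases hij : i = j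
  · rw [hij, H.self]
  · have hne : u i.castSucc z ≠ u j.castSucc z := fun h => hij (hS.injective hz h)
    have h := (H.row_row (rowJet z (u i.castSucc z)) (rowJet z (u j.castSucc z)) hne (m + 1)
      le_rfl).2.1
    rw [hS.differential_u hU hz, hS.differential_u hU hz]
    simp [h]

lemma form_u_v (hU : IsOpen U) (hS : IsSklyanin U u v) (hz : z ∈ U) (H : Relations β s t z)
    (i j : Fin m) :
    β (differential (u i.castSucc) z) (differential (v j.castSucc) z)
      = if i = j then s + t * u i.castSucc z else 0 := by
  have hA : aeval (u j.castSucc z) (rowA z (m + 1)) ≠ 0 := by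
    rw [hS.aeval_rowA hz]; exact Complex.exp_ne_zero _
  have hB := hS.aeval_derivative_rowB_ne_zero hz i
  rw [hS.differential_v hU hz, map_neg, map_smul, map_add, map_smul, hS.form_u_u hU hz H,
    hS.differential_u hU hz, map_neg, map_smul, LinearMap.neg_apply, LinearMap.smul_apply,
    hS.form_B_A hz H]
  split_ifs with hij
  · subst hij
    simp only [smul_eq_mul]
    field_simp
    ring
  · simp

lemma form_v_v (hU : IsOpen U) (hS : IsSklyanin U u v) (hz : z ∈ U) (H : Relations β s t z)
    (i j : Fin m) :
    β (differential (v i.castSucc) z) (differential (v j.castSucc) z) = 0 := by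
  by_cases hij : i = j
  · rw [hij, H.self]
  have hne : u i.castSucc z ≠ u j.castSucc z := fun h => hij (hS.injective hz h)
  have haa := (H.row_row (rowJet z (u i.castSucc z)) (rowJet z (u j.castSucc z)) hne (m + 1)
    le_rfl).1
  have h1 : β (differential (u i.castSucc) z)
      (differential (fun w => aeval (u j.castSucc z) (rowA w (m + 1))) z) = 0 := by
    rw [hS.differential_u hU hz, map_neg, map_smul, LinearMap.neg_apply, LinearMap.smul_apply,
      hS.form_B_A hz H, if_neg hij]
    simp
  have h2 : β (differential (fun w => aeval (u i.castSucc z) (rowA w (m + 1))) z)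
      (differential (u j.castSucc) z) = 0 := by
    rw [H.alt, hS.differential_u hU hz, map_neg, map_smul, LinearMap.neg_apply,
      LinearMap.smul_apply, hS.form_B_A hz H, if_neg (Ne.symm hij)]
    simp
  rw [hS.differential_v hU hz, hS.differential_v hU hz]
  simp only [map_neg, map_smul, map_add, LinearMap.neg_apply, LinearMap.smul_apply,
    LinearMap.add_apply, haa, h1, h2, hS.form_u_u hU hz H]
  simp

/-- At a zero of B only the boundary term e^{q_n} A of `total_row` survives. Division by -B' cancels
e^{q_n} = e^{-v_n}. -/
lemma form_ulast_u (hU : IsOpen U) (hS : IsSklyanin U u v) (hz : z ∈ U) (H : Relations β s t z)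
    (i : Fin m) :
    β (differential (u (Fin.last m)) z) (differential (u i.castSucc) z) = t * fCoef u v i z := by
  have hB := hS.aeval_derivative_rowB_ne_zero hz i
  rw [hS.eval_derivative_polyB hz] at hB
  have hprod := right_ne_zero_of_mul hB
  have h := (H.total_row (rowJet z (u i.castSucc z)) (m + 1) le_rfl).2
  simp only [hS.aeval_rowB hz, hS.aeval_rowA hz, if_neg (Nat.succ_ne_zero m),
    Nat.add_sub_cancel, ← hS.exp_last hz] at h
  rw [hS.differential_u_last hU hz, hS.differential_u hU hz, map_neg, map_smul, h,
    hS.eval_derivative_polyB hz, fCoef, smul_eq_mul]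
  have := Complex.exp_ne_zero (-v (Fin.last m) z)
  field_simp
  ring

/-- The total momentum commutes with A at fixed λ, so only the part of dv_i along du_i contributes:
the bracket is -(A'/A) t f_i. -/
lemma form_ulast_v (hU : IsOpen U) (hS : IsSklyanin U u v) (hz : z ∈ U) (H : Relations β s t z)
    (i : Fin m) :
    β (differential (u (Fin.last m)) z) (differential (v i.castSucc) z) = t * gCoef u v i z := by
  have hB := hS.aeval_derivative_rowB_ne_zero hz i
  rw [hS.eval_derivative_polyB hz] at hB
  have hprod := right_ne_zero_of_mul hB
  have h := (H.total_row (rowJet z (u i.castSucc z)) (m + 1) le_rfl).1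
  rw [hS.differential_v hU hz, map_neg, map_smul, map_add, map_smul, hS.form_ulast_u hU hz H,
    hS.differential_u_last hU hz, h, gCoef, fCoef, Toda.eval_derivative_polyB,
    Toda.eval_derivative_polyA, hS.eval_derivative_polyB hz, hS.aeval_rowA hz]
  have := Complex.exp_ne_zero (-v (Fin.last m) z)
  have := Complex.exp_ne_zero (-v i.castSucc z)
  simp only [smul_eq_mul]
  field_simp
  ring

lemma form_vlast_u (hU : IsOpen U) (hS : IsSklyanin U u v) (hz : z ∈ U) (H : Relations β s t z)
    (i : Fin m) :
    β (differential (v (Fin.last m)) z) (differential (u i.castSucc) z) = 0 := by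
  have h := (H.last_pos_row (rowJet z (u i.castSucc z)) m (Nat.lt_succ_self m)).2
  rw [hS.differential_v_last hU hz, hS.differential_u hU hz]
  simp [h]

/-- At a zero of B also A_{n-1} vanishes. The recursion then reads A = e^{-q_n} B_{n-1}, which is
exactly the surviving term of {q_n, A}, and it cancels against 1/A. -/
lemma form_vlast_v (hU : IsOpen U) (hS : IsSklyanin U u v) (hz : z ∈ U) (H : Relations β s t z)
    (i : Fin m) :
    β (differential (v (Fin.last m)) z) (differential (v i.castSucc) z) = t := by
  have h := (H.last_pos_row (rowJet z (u i.castSucc z)) m (Nat.lt_succ_self m)).1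
  have ha : aeval (u i.castSucc z) (rowA z m) = 0 := by
    have hb := hS.aeval_rowB hz i
    rw [aeval_rowB_succ, neg_eq_zero] at hb
    exact (mul_eq_zero.1 hb).resolve_left (Complex.exp_ne_zero _)
  have hA := aeval_rowA_succ z m (u i.castSucc z)
  have hA0 : aeval (u i.castSucc z) (rowA z (m + 1)) ≠ 0 := by
    rw [hS.aeval_rowA hz]; exact Complex.exp_ne_zero _
  rw [ha, mul_zero, zero_add] at hA
  simp only [ha, mul_zero, sub_zero, mul_assoc, Complex.ofReal_exp, Complex.ofReal_neg,
    ← hA] at h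
  rw [hS.differential_v hU hz, map_neg, map_smul, map_add, map_smul, hS.form_vlast_u hU hz H,
    hS.differential_v_last hU hz, map_neg, LinearMap.neg_apply, h]
  simp only [smul_eq_mul]
  field_simp
  ring

lemma form_ulast_vlast (hU : IsOpen U) (hS : IsSklyanin U u v) (hz : z ∈ U)
    (H : Relations β s t z) :
    β (differential (u (Fin.last m)) z) (differential (v (Fin.last m)) z)
      = s + t * sCoef u z := by
  rw [hS.differential_u_last hU hz, hS.differential_v_last hU hz, map_neg,
    H.total_last_pos m (Nat.lt_succ_self m), hS.sCoef_eq hz, neg_neg]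

end IsSklyanin

section Coordinates

variable {n : ℕ}

lemma jacobian_mul_mul_transpose (biv : Phase n → Matrix (Idx n) (Idx n) ℂ)
    (X : Idx n → Phase n → ℂ) (z : Phase n) :
    jacobian X z * biv z * (jacobian X z).transpose
      = Matrix.of fun a b => bracket biv (X a) (X b) z := by
  ext a b
  simp only [Matrix.mul_apply, Matrix.transpose_apply, jacobian, Matrix.of_apply, bracket,
    Finset.sum_mul]
  rw [Finset.sum_comm]
  exact Finset.sum_congr rfl fun c _ => Finset.sum_congr rfl fun d _ => by ring

lemma P_inv (n : ℕ) (z : Phase n) : (P n z)⁻¹ = Matrix.J (Fin n) ℂ := by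
  refine Matrix.inv_eq_right_inv ?_
  rw [P_eq_neg_J, neg_mul, Matrix.J_squared, neg_neg]

/-- Canonical brackets say that the Jacobian preserves the bivector P = -J under congruence.
Invertibility of the Jacobian comes for free. -/
lemma jacobian_mem_symplecticGroup {x y : Fin n → Phase n → ℂ} {z : Phase n}
    (h : ∀ i j, bracket (P n) (x i) (y j) z = (if i = j then 1 else 0) ∧
      bracket (P n) (x i) (x j) z = 0 ∧ bracket (P n) (y i) (y j) z = 0) :
    jacobian (pair x y) z ∈ Matrix.symplecticGroup (Fin n) ℂ := by
  have hanti : ∀ F G, bracket (P n) F G z = -bracket (P n) G F z := fun F G => by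
    rw [bracket_eq, bracket_eq, toBilin'_alt (P_transpose n z)]
  rw [SymplecticGroup.mem_iff, ← neg_neg (Matrix.J (Fin n) ℂ), ← P_eq_neg_J n z, mul_neg, neg_mul,
    jacobian_mul_mul_transpose, neg_inj, P_eq_neg_J]
  ext a b
  rcases a with i | i <;> rcases b with j | j
  · simp [pair, Matrix.J, h]
  · simp [pair, Matrix.J, h, Matrix.one_apply]
  · simp [pair, Matrix.J, hanti (y i), h, Matrix.one_apply, eq_comm]
  · simp [pair, Matrix.J, h]

/-- The symplectic group is closed under transposition. The transposed identity is the statement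
about two-forms instead of bivectors. -/
lemma symplecticForm_eq_sum_wedgeForm {x y : Fin n → Phase n → ℂ} {z : Phase n}
    (h : jacobian (pair x y) z ∈ Matrix.symplecticGroup (Fin n) ℂ) :
    symplecticForm n z = ∑ i, wedgeForm (x i) (y i) z := by
  rw [symplecticForm, P_inv, Matrix.J_transpose, ← SymplecticGroup.mem_iff'.1 h]
  ext a b
  simp only [Matrix.neg_apply, Matrix.mul_apply, Fintype.sum_sum_type, Matrix.transpose_apply,
    Matrix.sum_apply, wedgeForm, Matrix.sub_apply, Matrix.vecMulVec_apply]
  simp [Matrix.J, jacobian, pair, Matrix.one_apply, Finset.sum_sub_distrib]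
  rw [sub_eq_add_neg]

/-- In the dual frame ∂/∂X_a ⊗ dX_b is a matrix unit, so expanding a tensor amounts to conjugating
it by the Jacobian and reading off entries. -/
lemma tens_eq (X : Idx n → Phase n → ℂ) (a b : Idx n) (z : Phase n) :
    tens X a b z = (jacobian X z)⁻¹ * Matrix.single a b 1 * jacobian X z := by
  rw [Matrix.single_eq_single_vecMulVec_single, Matrix.mul_vecMulVec, Matrix.vecMulVec_mul,
    Matrix.mulVec_single_one, Matrix.single_one_vecMul]
  rfl

lemma jacobian_mul_tens_mul_inv {X : Idx n → Phase n → ℂ} {z : Phase n}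
    (h : IsUnit (jacobian X z)) (a b : Idx n) :
    jacobian X z * tens X a b z * (jacobian X z)⁻¹ = Matrix.single a b 1 := by
  have hdet := (Matrix.isUnit_iff_isUnit_det _).1 h
  rw [tens_eq, mul_assoc, mul_assoc, Matrix.mul_nonsing_inv _ hdet, mul_one,
    ← mul_assoc, Matrix.mul_nonsing_inv _ hdet, one_mul]

/-- The matrix of `Π P⁻¹` in Darboux coordinates. -/
lemma jacobian_conj {biv : Phase n → Matrix (Idx n) (Idx n) ℂ} {x y : Fin n → Phase n → ℂ}
    {z : Phase n} (h : jacobian (pair x y) z ∈ Matrix.symplecticGroup (Fin n) ℂ) :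
    jacobian (pair x y) z * (biv z * (P n z)⁻¹) * (jacobian (pair x y) z)⁻¹
      = (Matrix.of fun a b => bracket biv (pair x y a) (pair x y b) z) * Matrix.J (Fin n) ℂ := by
  have hdet := SymplecticGroup.symplectic_det h
  have hJ : Matrix.J (Fin n) ℂ * (jacobian (pair x y) z)⁻¹
      = (jacobian (pair x y) z).transpose * Matrix.J (Fin n) ℂ := by
    have h' := congrArg (· * (jacobian (pair x y) z)⁻¹) (SymplecticGroup.mem_iff'.1 h)
    simp only [mul_assoc, Matrix.mul_nonsing_inv _ hdet, mul_one] at h'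
    exact h'.symm
  rw [P_inv, ← jacobian_mul_mul_transpose]
  simp only [mul_assoc, hJ]

lemma mul_J_apply_inl (M : Matrix (Idx n) (Idx n) ℂ) (a : Idx n) (j : Fin n) :
    (M * Matrix.J (Fin n) ℂ) a (Sum.inl j) = M a (Sum.inr j) := by
  simp [Matrix.mul_apply, Matrix.J, Matrix.one_apply]

lemma mul_J_apply_inr (M : Matrix (Idx n) (Idx n) ℂ) (a : Idx n) (j : Fin n) :
    (M * Matrix.J (Fin n) ℂ) a (Sum.inr j) = -M a (Sum.inl j) := by
  simp [Matrix.mul_apply, Matrix.J, Matrix.one_apply]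

/-- The expansion of `Π P⁻¹` in the frame of Darboux coordinates. -/
lemma mul_P_inv_eq_sum_tens {biv : Phase n → Matrix (Idx n) (Idx n) ℂ}
    {x y : Fin n → Phase n → ℂ} {z : Phase n}
    (h : jacobian (pair x y) z ∈ Matrix.symplecticGroup (Fin n) ℂ) :
    biv z * (P n z)⁻¹ = ∑ a, ∑ j : Fin n,
      (bracket biv (pair x y a) (y j) z • tens (pair x y) a (Sum.inl j) z
        - bracket biv (pair x y a) (x j) z • tens (pair x y) a (Sum.inr j) z) := by
  have hdet := SymplecticGroup.symplectic_det h
  have hN : biv z * (P n z)⁻¹ = (jacobian (pair x y) z)⁻¹ *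
      ((Matrix.of fun a b => bracket biv (pair x y a) (pair x y b) z) * Matrix.J (Fin n) ℂ) *
      jacobian (pair x y) z := by
    rw [← jacobian_conj h]
    simp only [mul_assoc, Matrix.nonsing_inv_mul _ hdet, mul_one]
    rw [← mul_assoc, Matrix.nonsing_inv_mul _ hdet, one_mul]
  rw [hN, Matrix.matrix_eq_sum_single ((Matrix.of fun a b => bracket biv (pair x y a)
    (pair x y b) z) * Matrix.J (Fin n) ℂ), Finset.mul_sum, Finset.sum_mul]
  refine Finset.sum_congr rfl fun a _ => ?_
  rw [Finset.mul_sum, Finset.sum_mul, Fintype.sum_sum_type, ← Finset.sum_add_distrib]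
  refine Finset.sum_congr rfl fun j _ => ?_
  have hs : ∀ (b : Idx n) (c : ℂ), Matrix.single a b c = c • Matrix.single a b (1 : ℂ) :=
    fun b c => by simp [Matrix.smul_single]
  rw [mul_J_apply_inl, mul_J_apply_inr, hs _ (-_), hs, mul_smul_comm, smul_mul_assoc,
    mul_smul_comm, smul_mul_assoc, ← tens_eq, ← tens_eq, neg_smul, ← sub_eq_add_neg]
  rfl

end Coordinates

end Toda

/-! ### Global existence: ordered roots and the principal logarithm. -/

namespace Toda

open Polynomial Filter Topology

section Existence

variable {m : ℕ}

lemma card_roots_rowA (z : Phase (m + 1)) : (rowA z m).roots.toFinset.card = m := by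
  refine le_antisymm ?_ ?_
  · exact (Multiset.toFinset_card_le _).trans ((card_roots' _).trans (natDegree_rowA z m).le)
  · have hreal : ∀ l ∈ (polyB z).roots, l = (l.re : ℂ) := fun l hl => by
      apply Complex.ext <;> simp [im_eq_zero_of_aeval_rowB z m (aeval_rowB_of_mem hl)]
    have hcard : (polyB z).roots.toFinset.card = m := by
      rw [Multiset.toFinset_card_of_nodup (nodup_roots_polyB z), card_roots_polyB]
    have himage : ((polyB z).roots.toFinset.image Complex.re).card = m := by
      rw [Finset.card_image_of_injOn, hcard]
      intro a ha b hb hab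
      rw [Finset.mem_coe, Multiset.mem_toFinset] at ha hb
      rw [hreal a ha, hreal b hb, hab]
    refine himage.ge.trans (Finset.card_le_card fun t ht => ?_)
    obtain ⟨l, hl, rfl⟩ := Finset.mem_image.1 ht
    rw [Multiset.mem_toFinset] at hl ⊢
    have hl' := hl
    rw [roots_polyB, mem_roots', hreal l hl] at hl'
    rw [mem_roots (rowA_monic z m).ne_zero]
    exact IsRoot.of_map (f := Complex.ofRealHom) hl'.2 Complex.ofRealHom.injective

/-- The roots of `B` in increasing order. -/
def sortedRoots (z : Phase (m + 1)) : Fin m ↪o ℝ :=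
  (rowA z m).roots.toFinset.orderEmbOfFin (card_roots_rowA z)

lemma roots_polyB_eq_sortedRoots (z : Phase (m + 1)) :
    (polyB z).roots = (Finset.univ : Finset (Fin m)).val.map fun j => (sortedRoots z j : ℂ) := by
  have hinj : Function.Injective fun j : Fin m => (sortedRoots z j : ℂ) :=
    Complex.ofReal_injective.comp (sortedRoots z).injective
  symm
  refine Multiset.eq_of_le_of_card_le ?_ ?_
  · rw [Multiset.le_iff_subset (Multiset.Nodup.map hinj Finset.univ.nodup)]
    intro l hl
    obtain ⟨j, -, rfl⟩ := Multiset.mem_map.1 hl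
    have hj := Finset.orderEmbOfFin_mem _ (card_roots_rowA z) j
    rw [Multiset.mem_toFinset] at hj
    rw [roots_polyB, mem_roots ((rowA_monic z m).map _).ne_zero]
    exact (mem_roots'.1 hj).2.map (f := Complex.ofRealHom)
  · rw [card_roots_polyB]; simp

lemma rowA_eq_prod_sortedRoots (z : Phase (m + 1)) :
    rowA z m = ∏ j, (X - C (sortedRoots z j)) := by
  refine Polynomial.map_injective _ Complex.ofRealHom.injective ?_
  rw [map_rowA_eq_prod, roots_polyB_eq_sortedRoots, Multiset.map_map, Polynomial.map_prod]
  simp only [Polynomial.map_sub, map_X, map_C]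
  rfl

lemma eval_eq_re_aeval (f : ℝ[X]) (t : ℝ) : f.eval t = (aeval (t : ℂ) f).re := by
  have : aeval (t : ℂ) f = ((f.eval t : ℝ) : ℂ) := by
    simpa using aeval_algebraMap_apply_eq_algebraMap_eval (A := ℂ) t f
  rw [this, Complex.ofReal_re]

lemma continuous_eval_rowA (k : ℕ) :
    Continuous fun w : Phase (m + 1) × ℝ => (rowA w.1 k).eval w.2 := by
  simp only [eval_eq_re_aeval]
  exact Complex.continuous_re.comp ((contDiff_rowA k).continuous.comp
    (continuous_fst.prodMk (Complex.continuous_ofReal.comp continuous_snd)))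

/-- Simple roots persist: the sign changes of A_{n-1} around each root survive small perturbations
and give one root in each of m disjoint intervals. These are all the roots, in increasing order. -/
lemma continuous_sortedRoots (j : Fin m) :
    Continuous fun z : Phase (m + 1) => sortedRoots z j := by
  rw [continuous_iff_continuousAt]
  intro z
  rw [Metric.continuousAt_iff']
  intro ε hε
  set r := sortedRoots z with hr
  obtain ⟨δ, ⟨hδε, hgap⟩, hδ⟩ : ∃ δ, (δ < ε ∧ ∀ i k, i ≠ k → δ + δ < |r i - r k|) ∧ 0 < δ := by
    have h1 : ∀ᶠ δ : ℝ in 𝓝[>] 0, δ < ε :=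
      mem_nhdsWithin_of_mem_nhds (Iio_mem_nhds hε)
    have h2 : ∀ᶠ δ : ℝ in 𝓝[>] 0, ∀ i k, i ≠ k → δ + δ < |r i - r k| := by
      refine eventually_all.2 fun i => eventually_all.2 fun k => ?_
      by_cases hik : i = k
      · simp [hik]
      have hpos : 0 < |r i - r k| / 2 := half_pos (abs_pos.2 (sub_ne_zero.2 (r.injective.ne hik)))
      filter_upwards [mem_nhdsWithin_of_mem_nhds (Iio_mem_nhds hpos)] with δ hδ _
      have : δ < |r i - r k| / 2 := hδ
      linarith
    obtain ⟨δ, h⟩ := ((h1.and h2).and self_mem_nhdsWithin).exists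
    exact ⟨δ, h⟩
  -- The factors pair up as (r_i - r_k)² - δ², which is positive for k ≠ i by the gap condition and
  -- equals -δ² for k = i.
  have hsign : ∀ i, (rowA z m).eval (r i - δ) * (rowA z m).eval (r i + δ) < 0 := by
    intro i
    rw [rowA_eq_prod_sortedRoots, eval_prod, eval_prod, ← Finset.prod_mul_distrib,
      ← Finset.mul_prod_erase _ _ (Finset.mem_univ i)]
    refine mul_neg_of_neg_of_pos ?_ (Finset.prod_pos fun k hk => ?_)
    · simp only [eval_sub, eval_X, eval_C, ← hr]
      nlinarith
    · have h := hgap i k (Finset.ne_of_mem_erase hk).symm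
      have h3 : δ ^ 2 < |r i - r k| ^ 2 := by
        have := abs_nonneg (r i - r k)
        nlinarith
      rw [sq_abs] at h3
      simp only [eval_sub, eval_X, eval_C, ← hr]
      nlinarith
  have hev : ∀ᶠ w in 𝓝 z, ∀ i, (rowA w m).eval (r i - δ) * (rowA w m).eval (r i + δ) < 0 := by
    refine eventually_all.2 fun i => ?_
    have hc : Continuous fun w : Phase (m + 1) =>
        (rowA w m).eval (r i - δ) * (rowA w m).eval (r i + δ) :=
      ((continuous_eval_rowA m).comp (continuous_id.prodMk continuous_const)).mul
        ((continuous_eval_rowA m).comp (continuous_id.prodMk continuous_const))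
    exact hc.continuousAt.eventually_lt continuousAt_const (hsign i)
  filter_upwards [hev] with w hw
  have hroot : ∀ i, ∃ x ∈ Set.Icc (r i - δ) (r i + δ), (rowA w m).eval x = 0 := by
    intro i
    have hle : r i - δ ≤ r i + δ := by linarith
    have hcont := (rowA w m).continuous.continuousOn (s := Set.Icc (r i - δ) (r i + δ))
    rcases mul_neg_iff.1 (hw i) with h | h
    · exact intermediate_value_Icc' hle hcont ⟨h.2.le, h.1.le⟩
    · exact intermediate_value_Icc hle hcont ⟨h.1.le, h.2.le⟩
  choose x hx hx0 using hroot
  have hmono : StrictMono x := by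
    intro i k hik
    have h1 := hgap i k hik.ne
    have h2 : r i < r k := r.strictMono hik
    rw [abs_of_neg (sub_neg.2 h2)] at h1
    linarith [(hx i).2, (hx k).1]
  have hxr : x = sortedRoots w :=
    Finset.orderEmbOfFin_unique (card_roots_rowA w) (fun i => by
      rw [Multiset.mem_toFinset, mem_roots (rowA_monic w m).ne_zero]
      exact hx0 i) hmono
  rw [← hxr, Real.dist_eq, abs_lt]
  constructor <;> linarith [(hx j).1, (hx j).2]

/-- The cut along the negative axis does no harm on the real line, where the argument is constantly
π for negative numbers. Since A(u_j) is real and nonzero, the principal branch is continuous. -/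
lemma continuousAt_clog_ofReal {t : ℝ} (ht : t ≠ 0) :
    ContinuousAt (fun t : ℝ => Complex.log t) t := by
  rcases ht.lt_or_gt with h | h
  · have hev : (fun t : ℝ => (Real.log t : ℂ) + Real.pi * Complex.I) =ᶠ[𝓝 t]
        fun t : ℝ => Complex.log t := by
      filter_upwards [Iio_mem_nhds h] with s hs
      simp [Complex.log, Complex.arg_ofReal_of_neg hs]
    exact ContinuousAt.congr ((Complex.continuous_ofReal.continuousAt.comp
      (Real.continuousAt_log ht)).add continuousAt_const) hev
  · exact (continuousAt_clog (Complex.ofReal_mem_slitPlane.2 h)).comp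
      Complex.continuous_ofReal.continuousAt

theorem exists_isSklyanin (m : ℕ) : ∃ u v : Fin (m + 1) → Phase (m + 1) → ℂ,
    IsSklyanin Set.univ u v ∧
    ∀ z, ∀ j : Fin m, v j.castSucc z = -Complex.log ((polyA z).eval (u j.castSucc z)) := by
  have hA : ∀ (z : Phase (m + 1)) (j : Fin m), (polyA z).eval (sortedRoots z j : ℂ)
      = (((rowA z (m + 1)).eval (sortedRoots z j) : ℝ) : ℂ) := fun z j => by
    rw [polyA_eq]; exact eval_map_apply (f := Complex.ofRealHom) _
  have hA0 : ∀ (z : Phase (m + 1)) (j : Fin m), (polyA z).eval (sortedRoots z j : ℂ) ≠ 0 := by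
    intro z j
    rw [eval_polyA]
    refine left_ne_zero_of_mul (aeval_wronskian_ne_zero z m (aeval_rowB_of_mem ?_))
    rw [roots_polyB_eq_sortedRoots]
    exact Multiset.mem_map_of_mem _ (Finset.mem_univ j)
  refine ⟨fun i z => Fin.lastCases (∑ i, (p z i : ℂ)) (fun j => (sortedRoots z j : ℂ)) i,
    fun i z => Fin.lastCases (-(q z (Fin.last m) : ℂ))
      (fun j => -Complex.log ((polyA z).eval (sortedRoots z j : ℂ))) i, ⟨?_, ?_, ?_, ?_, ?_, ?_⟩, ?_⟩
  · intro j
    simp only [Fin.lastCases_castSucc]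
    exact (Complex.continuous_ofReal.comp (continuous_sortedRoots j)).continuousOn
  · intro j
    simp only [Fin.lastCases_castSucc, hA]
    refine (Continuous.neg (continuous_iff_continuousAt.2 fun z => ?_)).continuousOn
    have hc : Continuous fun z : Phase (m + 1) => (rowA z (m + 1)).eval (sortedRoots z j) :=
      (continuous_eval_rowA (m + 1)).comp (continuous_id.prodMk (continuous_sortedRoots j))
    have h0 := hA0 z j
    rw [hA, Complex.ofReal_ne_zero] at h0
    exact ContinuousAt.comp (f := fun z : Phase (m + 1) => (rowA z (m + 1)).eval (sortedRoots z j))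
      (continuousAt_clog_ofReal h0) hc.continuousAt
  · intro z _
    simp only [Fin.lastCases_castSucc]
    exact roots_polyB_eq_sortedRoots z
  · intro z _ j
    simp only [Fin.lastCases_castSucc, neg_neg]
    exact Complex.exp_log (hA0 z j)
  · intro z _; simp
  · intro z _; simp
  · intro z j; simp

end Existence

end Toda

/-! ### Bracket tables, the recursion operator and failure of diagonality. -/

namespace Toda

namespace IsSklyanin

variable {m : ℕ} {U : Set (Phase (m + 1))} {u v : Fin (m + 1) → Phase (m + 1) → ℂ}
  {z : Phase (m + 1)}

lemma bracket_P (hU : IsOpen U) (hS : IsSklyanin U u v) (hz : z ∈ U) (i j : Fin (m + 1)) :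
    bracket (P (m + 1)) (u i) (v j) z = (if i = j then 1 else 0) ∧
      bracket (P (m + 1)) (u i) (u j) z = 0 ∧ bracket (P (m + 1)) (v i) (v j) z = 0 := by
  have H := relations_P z
  simp only [bracket_eq]
  induction i using Fin.lastCases with
  | last =>
    induction j using Fin.lastCases with
    | last => simp [hS.form_ulast_vlast hU hz H, H.self]
    | cast j =>
      rw [if_neg (Fin.castSucc_ne_last j).symm, hS.form_ulast_u hU hz H, hS.form_ulast_v hU hz H,
        hS.form_vlast_v hU hz H]
      simp
  | cast i =>
    induction j using Fin.lastCases with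
    | last =>
      rw [if_neg (Fin.castSucc_ne_last i), H.alt (differential (u i.castSucc) z),
        H.alt (differential (u i.castSucc) z), H.alt (differential (v i.castSucc) z),
        hS.form_ulast_u hU hz H, hS.form_vlast_u hU hz H, hS.form_vlast_v hU hz H]
      simp
    | cast j =>
      rw [hS.form_u_v hU hz H, hS.form_u_u hU hz H, hS.form_v_v hU hz H]
      simp

lemma bracket_P'_neg (F G : Phase (m + 1) → ℂ) (z : Phase (m + 1)) :
    bracket (P' m) F G z = -bracket (P' m) G F z := by
  rw [bracket_eq, bracket_eq, toBilin'_alt (P'_transpose z)]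

lemma bracket_P'_u_v (hU : IsOpen U) (hS : IsSklyanin U u v) (hz : z ∈ U) (i j : Fin m) :
    bracket (P' m) (u i.castSucc) (v j.castSucc) z = if i = j then u i.castSucc z else 0 := by
  rw [bracket_eq, hS.form_u_v hU hz (relations_P' z), zero_add, one_mul]

lemma bracket_P'_u_u (hU : IsOpen U) (hS : IsSklyanin U u v) (hz : z ∈ U) (i j : Fin m) :
    bracket (P' m) (u i.castSucc) (u j.castSucc) z = 0 := by
  rw [bracket_eq, hS.form_u_u hU hz (relations_P' z)]

lemma bracket_P'_v_v (hU : IsOpen U) (hS : IsSklyanin U u v) (hz : z ∈ U) (i j : Fin m) :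
    bracket (P' m) (v i.castSucc) (v j.castSucc) z = 0 := by
  rw [bracket_eq, hS.form_v_v hU hz (relations_P' z)]

lemma bracket_P'_ulast_u (hU : IsOpen U) (hS : IsSklyanin U u v) (hz : z ∈ U) (i : Fin m) :
    bracket (P' m) (u (Fin.last m)) (u i.castSucc) z = fCoef u v i z := by
  rw [bracket_eq, hS.form_ulast_u hU hz (relations_P' z), one_mul]

lemma bracket_P'_ulast_v (hU : IsOpen U) (hS : IsSklyanin U u v) (hz : z ∈ U) (i : Fin m) :
    bracket (P' m) (u (Fin.last m)) (v i.castSucc) z = gCoef u v i z := by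
  rw [bracket_eq, hS.form_ulast_v hU hz (relations_P' z), one_mul]

lemma bracket_P'_vlast_u (hU : IsOpen U) (hS : IsSklyanin U u v) (hz : z ∈ U) (i : Fin m) :
    bracket (P' m) (v (Fin.last m)) (u i.castSucc) z = 0 := by
  rw [bracket_eq, hS.form_vlast_u hU hz (relations_P' z)]

lemma bracket_P'_vlast_v (hU : IsOpen U) (hS : IsSklyanin U u v) (hz : z ∈ U) (i : Fin m) :
    bracket (P' m) (v (Fin.last m)) (v i.castSucc) z = 1 := by
  rw [bracket_eq, hS.form_vlast_v hU hz (relations_P' z)]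

lemma bracket_P'_ulast_vlast (hU : IsOpen U) (hS : IsSklyanin U u v) (hz : z ∈ U) :
    bracket (P' m) (u (Fin.last m)) (v (Fin.last m)) z = sCoef u z := by
  rw [bracket_eq, hS.form_ulast_vlast hU hz (relations_P' z), zero_add, one_mul]

lemma bracket_P'_self (F : Phase (m + 1) → ℂ) (z : Phase (m + 1)) :
    bracket (P' m) F F z = 0 := by
  rw [bracket_eq, (relations_P' z).self]

lemma jacobian_mem (hU : IsOpen U) (hS : IsSklyanin U u v) (hz : z ∈ U) :
    jacobian (pair u v) z ∈ Matrix.symplecticGroup (Fin (m + 1)) ℂ :=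
  jacobian_mem_symplecticGroup (hS.bracket_P hU hz)

lemma isDarboux (hU : IsOpen U) (hS : IsSklyanin U u v) : IsDarboux U u v where
  coords :=
    { smooth := hS.contDiffOn hU
      injOn := hS.injOn
      isUnit_jacobian := fun _ hz => (Matrix.isUnit_iff_isUnit_det _).2
        (SymplecticGroup.symplectic_det (hS.jacobian_mem hU hz)) }
  canonical _ hz := symplecticForm_eq_sum_wedgeForm (hS.jacobian_mem hU hz)

lemma recursionOperator_eq (hU : IsOpen U) (hS : IsSklyanin U u v) (hz : z ∈ U) :
    recursionOperator m z =
      (∑ i : Fin m, u i.castSucc z •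
        (tens (pair u v) (Sum.inl i.castSucc) (Sum.inl i.castSucc) z
          + tens (pair u v) (Sum.inr i.castSucc) (Sum.inr i.castSucc) z))
      + sCoef u z •
        (tens (pair u v) (Sum.inl (Fin.last m)) (Sum.inl (Fin.last m)) z
          + tens (pair u v) (Sum.inr (Fin.last m)) (Sum.inr (Fin.last m)) z)
      + (∑ i : Fin m, fCoef u v i z •
        (tens (pair u v) (Sum.inl i.castSucc) (Sum.inr (Fin.last m)) z
          - tens (pair u v) (Sum.inl (Fin.last m)) (Sum.inr i.castSucc) z))
      + (∑ i : Fin m,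
        (tens (pair u v) (Sum.inr (Fin.last m)) (Sum.inl i.castSucc) z
          - tens (pair u v) (Sum.inr i.castSucc) (Sum.inl (Fin.last m)) z))
      + (∑ i : Fin m, gCoef u v i z •
        (tens (pair u v) (Sum.inr i.castSucc) (Sum.inr (Fin.last m)) z
          + tens (pair u v) (Sum.inl (Fin.last m)) (Sum.inl i.castSucc) z)) := by
  rw [recursionOperator, mul_P_inv_eq_sum_tens (hS.jacobian_mem hU hz)]
  have hvu : ∀ i j : Fin m, bracket (P' m) (v i.castSucc) (u j.castSucc) z
      = if i = j then -u i.castSucc z else 0 := fun i j => by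
    rw [bracket_P'_neg, hS.bracket_P'_u_v hU hz]
    by_cases h : i = j
    · simp [h]
    · simp [h, Ne.symm h]
  have huu : ∀ i, bracket (P' m) (u (Fin.castSucc i)) (u (Fin.last m)) z = -fCoef u v i z :=
    fun i => by rw [bracket_P'_neg, hS.bracket_P'_ulast_u hU hz]
  have hvul : ∀ i, bracket (P' m) (v (Fin.castSucc i)) (u (Fin.last m)) z = -gCoef u v i z :=
    fun i => by rw [bracket_P'_neg, hS.bracket_P'_ulast_v hU hz]
  have huvl : ∀ i, bracket (P' m) (u (Fin.castSucc i)) (v (Fin.last m)) z = 0 :=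
    fun i => by rw [bracket_P'_neg, hS.bracket_P'_vlast_u hU hz, neg_zero]
  have hvvl : ∀ i, bracket (P' m) (v (Fin.castSucc i)) (v (Fin.last m)) z = -1 :=
    fun i => by rw [bracket_P'_neg, hS.bracket_P'_vlast_v hU hz]
  have hlast : bracket (P' m) (v (Fin.last m)) (u (Fin.last m)) z = -sCoef u z := by
    rw [bracket_P'_neg, hS.bracket_P'_ulast_vlast hU hz]
  have hl : ∀ i, pair u v (Sum.inl i) = u i := fun _ => rfl
  have hr : ∀ i, pair u v (Sum.inr i) = v i := fun _ => rfl
  simp only [Fintype.sum_sum_type, Fin.sum_univ_castSucc, hl, hr, hvu, huu, hvul, huvl, hvvl,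
    hlast, bracket_P'_self, hS.bracket_P'_u_v hU hz, hS.bracket_P'_u_u hU hz,
    hS.bracket_P'_v_v hU hz, hS.bracket_P'_ulast_u hU hz, hS.bracket_P'_ulast_v hU hz,
    hS.bracket_P'_vlast_u hU hz, hS.bracket_P'_vlast_v hU hz, hS.bracket_P'_ulast_vlast hU hz,
    ite_smul, zero_smul, neg_smul, one_smul, Finset.sum_sub_distrib,
    Finset.sum_add_distrib, Finset.sum_ite_eq, Finset.mem_univ, if_true, smul_add, smul_sub,
    Finset.sum_neg_distrib, Finset.sum_const_zero]
  abel

lemma not_isDarbouxNijenhuis (hU : IsOpen U) (hS : IsSklyanin U u v) (hm : 1 ≤ m)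
    (hne : U.Nonempty) : ¬ IsDarbouxNijenhuis U u v := by
  rintro ⟨hD, lam, hlam⟩
  obtain ⟨z, hz⟩ := hne
  have hconj := jacobian_conj (biv := P' m) (hS.jacobian_mem hU hz)
  have hunit := hD.coords.isUnit_jacobian z hz
  rw [show P' m z * (P (m + 1) z)⁻¹ = _ from hlam z hz, Finset.mul_sum, Finset.sum_mul] at hconj
  simp only [mul_smul_comm, smul_mul_assoc, mul_add, add_mul, jacobian_mul_tens_mul_inv hunit]
    at hconj
  -- The coefficient of ∂/∂v_n ⊗ du_1 is zero in a diagonal tensor, but in N it is {v_n, v_1}' = 1.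
  have hentry := congrFun (congrFun hconj (Sum.inr (Fin.last m)))
    (Sum.inl (Fin.castSucc ⟨0, hm⟩))
  rw [mul_J_apply_inl, Matrix.of_apply,
    show bracket (P' m) (pair u v (Sum.inr (Fin.last m)))
      (pair u v (Sum.inr (Fin.castSucc ⟨0, hm⟩))) z = 1 from hS.bracket_P'_vlast_v hU hz ⟨0, hm⟩]
    at hentry
  simp [Matrix.sum_apply] at hentry

end IsSklyanin

end Toda

end

theorem mainTheorem2 (m : ℕ) :
    -- global existence of Sklyanin variables, with the principal logarithm
    (∃ u v : Fin (m + 1) → Toda.Phase (m + 1) → ℂ,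
      Toda.IsSklyanin Set.univ u v ∧
      ∀ z, ∀ j : Fin m,
        v j.castSucc z = -Complex.log ((Toda.polyA z).eval (u j.castSucc z))) ∧
    -- every choice of Sklyanin variables on an open set
    (∀ (U : Set (Toda.Phase (m + 1))), IsOpen U →
      ∀ u v : Fin (m + 1) → Toda.Phase (m + 1) → ℂ, Toda.IsSklyanin U u v →
        -- reality, simplicity of the roots, factorization of `B`
        (∀ z ∈ U, ∀ i, (u i z).im = 0 ∧ ∃ k : ℤ, (v i z).im = k * Real.pi) ∧
        (∀ z ∈ U, Function.Injective fun j : Fin m => u j.castSucc z) ∧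
        (∀ z ∈ U, Toda.polyB z =
          -Polynomial.C (Complex.exp (-v (Fin.last m) z)) *
            ∏ j : Fin m, (Polynomial.X - Polynomial.C (u j.castSucc z))) ∧
        -- Darboux coordinates, `ω = ∑ du_i ∧ dv_i`
        Toda.IsDarboux U u v ∧
        -- first brackets
        (∀ z ∈ U, ∀ i j,
          Toda.bracket (Toda.P (m + 1)) (u i) (v j) z = (if i = j then 1 else 0) ∧
          Toda.bracket (Toda.P (m + 1)) (u i) (u j) z = 0 ∧
          Toda.bracket (Toda.P (m + 1)) (v i) (v j) z = 0) ∧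
        -- second brackets
        (∀ z ∈ U, ∀ i j : Fin m,
          Toda.bracket (Toda.P' m) (u i.castSucc) (v j.castSucc) z =
            (if i = j then u i.castSucc z else 0) ∧
          Toda.bracket (Toda.P' m) (u i.castSucc) (u j.castSucc) z = 0 ∧
          Toda.bracket (Toda.P' m) (v i.castSucc) (v j.castSucc) z = 0) ∧
        (∀ z ∈ U, ∀ i : Fin m,
          Toda.bracket (Toda.P' m) (u (Fin.last m)) (u i.castSucc) z = Toda.fCoef u v i z ∧
          Toda.bracket (Toda.P' m) (u (Fin.last m)) (v i.castSucc) z = Toda.gCoef u v i z ∧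
          Toda.bracket (Toda.P' m) (v (Fin.last m)) (u i.castSucc) z = 0 ∧
          Toda.bracket (Toda.P' m) (v (Fin.last m)) (v i.castSucc) z = 1) ∧
        (∀ z ∈ U,
          Toda.bracket (Toda.P' m) (u (Fin.last m)) (v (Fin.last m)) z = Toda.sCoef u z) ∧
        -- the recursion operator
        (∀ z ∈ U,
          Toda.recursionOperator m z =
            (∑ i : Fin m, u i.castSucc z •
              (Toda.tens (Toda.pair u v) (Sum.inl i.castSucc) (Sum.inl i.castSucc) z
                + Toda.tens (Toda.pair u v) (Sum.inr i.castSucc) (Sum.inr i.castSucc) z))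
            + Toda.sCoef u z •
              (Toda.tens (Toda.pair u v) (Sum.inl (Fin.last m)) (Sum.inl (Fin.last m)) z
                + Toda.tens (Toda.pair u v) (Sum.inr (Fin.last m)) (Sum.inr (Fin.last m)) z)
            + (∑ i : Fin m, Toda.fCoef u v i z •
              (Toda.tens (Toda.pair u v) (Sum.inl i.castSucc) (Sum.inr (Fin.last m)) z
                - Toda.tens (Toda.pair u v) (Sum.inl (Fin.last m)) (Sum.inr i.castSucc) z))
            + (∑ i : Fin m,
              (Toda.tens (Toda.pair u v) (Sum.inr (Fin.last m)) (Sum.inl i.castSucc) z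
                - Toda.tens (Toda.pair u v) (Sum.inr i.castSucc) (Sum.inl (Fin.last m)) z))
            + (∑ i : Fin m, Toda.gCoef u v i z •
              (Toda.tens (Toda.pair u v) (Sum.inr i.castSucc) (Sum.inr (Fin.last m)) z
                + Toda.tens (Toda.pair u v) (Sum.inl (Fin.last m)) (Sum.inl i.castSucc) z))) ∧
        -- for at least two particles these are not Darboux-Nijenhuis coordinates
        (1 ≤ m → U.Nonempty → ¬ Toda.IsDarbouxNijenhuis U u v)) := by
  refine ⟨Toda.exists_isSklyanin m, fun U hU u v hS => ?_⟩
  exact ⟨fun z hz i => ⟨hS.im_u hz i, hS.im_v hz i⟩, fun z hz => hS.injective hz,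
    fun z hz => hS.polyB_eq hz, hS.isDarboux hU, fun z hz i j => hS.bracket_P hU hz i j,
    fun z hz i j => ⟨hS.bracket_P'_u_v hU hz i j, hS.bracket_P'_u_u hU hz i j,
      hS.bracket_P'_v_v hU hz i j⟩,
    fun z hz i => ⟨hS.bracket_P'_ulast_u hU hz i, hS.bracket_P'_ulast_v hU hz i,
      hS.bracket_P'_vlast_u hU hz i, hS.bracket_P'_vlast_v hU hz i⟩,
    fun z hz => hS.bracket_P'_ulast_vlast hU hz, fun z hz => hS.recursionOperator_eq hU hz,
    fun hm hne => hS.not_isDarbouxNijenhuis hU hm hne⟩
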